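/- Let $M$ be a compact Riemann surface with canonical line bundle $K=(T^{(1,0)}M)^*$, and let $g$ be a smooth Riemannian metric on $M$ compatible with the complex structure, so that $g=e^{2\omega}(dx^2+dy^2)$ in every local holomorphic coordinate $z=x+iy$ (equivalently: $(M,g)$ is a compact oriented Riemannian surface with the complex structure determined by $g$ and the orientation). Let $S$ be a spin structure on $M$, i.e. a holomorphic line bundle $S\to M$ with a holomorphic isomorphism $S\otimes S\cong K$. Give $S$ the Hermitian metric $|s|_g^2=|s\otimes s|_g$, where $|dz|_g=e^{-\omega}$. The spinor bundle is $S\oplus\bar S$; for a smooth section $\psi=(\psi_+,\psi_-)$ put $|\psi|_g^2=|\psi_+|_g^2+|\psi_-|_g^2$, and let $$\mathcal D_g(\psi_+,\psi_-)=2\,(\partial_g\psi_-,\,-\bar\partial_g\psi_+)$$ be the Dirac operator, where, for a local holomorphic section $s_0$ of $S$ with $s_0\otimes s_0=dz$, $\bar\partial_g(fs_0)=|s_0|_g^2\,\frac{\partial f}{\partial\bar z}\,\bar s_0$ and $\partial_g(f\bar s_0)=|s_0|_g^2\,\frac{\partial f}{\partial z}\,s_0$. Let $\lambda\in\mathbb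 R$, $\lambda\neq0$, and let $\psi_1,\dots,\psi_m$ be smooth sections of $S\oplus\bar S$ with $\mathcal D_g\psi_j=\lambda\psi_j$ for all $j$ and $|\psi_1|_g^2+\dots+|\psi_m|_g^2=1$ on $M$. Then the map $$\Psi=[\psi_{1+}:\bar\psi_{1-}:\dots:\psi_{m+}:\bar\psi_{m-}]\colon M\to\mathbb{CP}^{2m-1}$$ (well defined, since at each point the entries lie in one fibre of $S$ and do not all vanish) is harmonic. That is, $\Psi$ is smooth, and for every smooth variation $(\Psi_t)_{|t|<\varepsilon}$ of $\Psi_0=\Psi$ one has $\frac{d}{dt}\big|_{t=0}E(\Psi_t)=0$, where $E(\Phi)=\frac12\int_M|d\Phi|^2\,dv_g$ and $|d\Phi|$ is the Hilbert–Schmidt norm with respect to $g$ and the metric $4g_{FS}$ on $\mathbb{CP}^{2m-1}$, $g_{FS}$ being the Fubini–Study metric of constant holomorphic sectional curvature $4$. -/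

import Mathlib

open scoped Manifold ContDiff Topology TensorProduct LinearAlgebra.Projectivization
open Bundle

noncomputable section

/-! ## Riemann surfaces

A Riemann surface is a complex one-dimensional manifold: a space `M` with
`[ChartedSpace ℂ M] [IsManifold 𝓘(ℂ) ω M]`. Its underlying real surface has the same charts and the
model `𝓘(ℝ, ℂ)`. The tangent space at `x` is a copy of `ℂ`, identified through the differential
of the preferred holomorphic chart `z = chartAt ℂ x`. -/

/-- A Riemann surface is a real analytic (in particular smooth) real surface. -/
instance RiemannSurface.isManifold_real {M : Type*} [TopologicalSpace M] [ChartedSpace ℂ M]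
    [h : IsManifold 𝓘(ℂ) ω M] : IsManifold 𝓘(ℝ, ℂ) ω M := by
  apply isManifold_of_contDiffOn
  intro e e' he he'
  have h1 := ((contDiffGroupoid ω 𝓘(ℂ)).compatible he he').1
  exact h1.restrict_scalars ℝ

section Surface

variable {M : Type*} [TopologicalSpace M] [ChartedSpace ℂ M]

/-- The coordinate vector `∂/∂x` at the point `x`, for the preferred chart `z = x + iy` there. -/
def tangentOne (x : M) : TangentSpace 𝓘(ℝ, ℂ) x := (1 : ℂ)

/-- The complex structure `J` of a Riemann surface, acting on its real tangent spaces. -/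
def tangentJ {x : M} (v : TangentSpace 𝓘(ℝ, ℂ) x) : TangentSpace 𝓘(ℝ, ℂ) x :=
  (Complex.I * (show ℂ from v) : ℂ)

variable (M) in
/-- A smooth Riemannian metric `g` on a Riemann surface that is compatible with the complex
structure, i.e. `g = Re h` for a Hermitian metric `h`. Equivalently, the complex structure is
the one which is determined by `g` and the orientation. -/
structure ConformalMetric [IsManifold 𝓘(ℂ) ω M] extends
    ContMDiffRiemannianMetric 𝓘(ℝ, ℂ) ∞ ℂ (fun x : M => TangentSpace 𝓘(ℝ, ℂ) x) where
  /-- The metric is invariant under the complex structure. -/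
  conformal (x : M) (v w : TangentSpace 𝓘(ℝ, ℂ) x) :
    inner x (tangentJ v) (tangentJ w) = inner x v w

variable [IsManifold 𝓘(ℂ) ω M]

/-- `|v|_g^2` for a tangent vector `v`. -/
def ConformalMetric.normSq (g : ConformalMetric M) (x : M) (v : TangentSpace 𝓘(ℝ, ℂ) x) : ℝ :=
  g.inner x v v

/-- The function `e^{2ω}` in the local expression `g = e^{2ω} (dx^2 + dy^2)` in the chart `φ`, at
the point `z` of the target of `φ`. Hence `dv_g = e^{2ω} dx dy`. -/
def ConformalMetric.chartDensity (g : ConformalMetric M) (φ : OpenPartialHomeomorph M ℂ) (z : ℂ) :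
    ℝ :=
  g.normSq (φ.symm z) (mfderiv 𝓘(ℝ, ℂ) 𝓘(ℝ, ℂ) φ.symm z (1 : ℂ))

variable (M) in
/-- A smooth partition of unity on `M` that is subordinate to the covering by chart domains. -/
def chartPartition [T2Space M] [CompactSpace M] :
    SmoothPartitionOfUnity M 𝓘(ℝ, ℂ) M Set.univ :=
  (SmoothPartitionOfUnity.exists_isSubordinate_chartAt_source 𝓘(ℝ, ℂ) M).choose

/-- The integral `∫_M u dv_g` with respect to the area of `g` on a compact surface: the sum of
the integrals in charts of the pieces of `u` cut out by a partition of unity. -/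
def ConformalMetric.integral [T2Space M] [CompactSpace M] (g : ConformalMetric M) (u : M → ℝ) : ℝ :=
  ∑ᶠ i : M, ∫ z in (chartAt ℂ i).target,
    chartPartition M i ((chartAt ℂ i).symm z) * u ((chartAt ℂ i).symm z) *
      g.chartDensity (chartAt ℂ i) z

end Surface

/-! ## Complex projective space and harmonic maps

`ℂP^{N-1}` is the space `ℙ ℂ (EuclideanSpace ℂ (Fin N))` of complex lines in `ℂ^N`. Its smooth
structure is the one for which `ℂ^N ∖ {0} → ℂP^{N-1}` is a smooth submersion. -/

section Projective

variable {N : ℕ}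

/-- A map into projective space is smooth at `x` if near `x` it has homogeneous coordinates
that are given by a nowhere vanishing function which is smooth at `x`. -/
def ProjSmoothAt {E H X : Type*} [NormedAddCommGroup E] [NormedSpace ℝ E] [TopologicalSpace H]
    (J : ModelWithCorners ℝ E H) [TopologicalSpace X] [ChartedSpace H X]
    (f : X → ℙ ℂ (EuclideanSpace ℂ (Fin N))) (x : X) : Prop :=
  ∃ F : X → EuclideanSpace ℂ (Fin N),
    ContMDiffAt J 𝓘(ℝ, EuclideanSpace ℂ (Fin N)) ∞ F x ∧
      ∀ᶠ y in 𝓝 x, ∃ hy : F y ≠ 0, f y = Projectivization.mk ℂ (F y) hy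

/-- The affine chart of projective space centred at the line `p`, spanned by `v = p.rep`:
a line `q` that is not orthogonal to `p` contains exactly one vector of the form `v + w` with `w`
orthogonal to `v`, and the chart maps `q` to `w`. It takes values in `v^⊥`, which, by the choice
of `v`, is identified with `T_p ℂP^{N-1} = Hom(p, p^⊥)`. -/
def projChart (p q : ℙ ℂ (EuclideanSpace ℂ (Fin N))) : EuclideanSpace ℂ (Fin N) :=
  ((‖p.rep‖ ^ 2 : ℂ) / inner ℂ p.rep q.rep) • q.rep - p.rep

variable {M : Type*} [TopologicalSpace M] [ChartedSpace ℂ M]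

/-- The differential at `x` of a map into projective space, in the affine chart centred at
the image of `x`. -/
def projDeriv (f : M → ℙ ℂ (EuclideanSpace ℂ (Fin N))) (x : M)
    (v : TangentSpace 𝓘(ℝ, ℂ) x) : EuclideanSpace ℂ (Fin N) :=
  mfderiv 𝓘(ℝ, ℂ) 𝓘(ℝ, EuclideanSpace ℂ (Fin N)) (fun y => projChart (f x) (f y)) x v

/-- `|df(v)|^2` for the metric `4 g_FS` on projective space, where `g_FS` is the Fubini-Study metric
of constant holomorphic sectional curvature `4`: the homomorphism in `Hom(p, p^⊥)` that sends `u`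
to `w` has squared length `4 |w|^2 / |u|^2`. -/
def projDerivNormSq (f : M → ℙ ℂ (EuclideanSpace ℂ (Fin N))) (x : M)
    (v : TangentSpace 𝓘(ℝ, ℂ) x) : ℝ :=
  4 * ‖projDeriv f x v‖ ^ 2 / ‖(f x).rep‖ ^ 2

variable [IsManifold 𝓘(ℂ) ω M]

/-- The squared Hilbert-Schmidt norm `|df|^2` at `x`. As `g` is conformal, `∂/∂x` and
`∂/∂y = J ∂/∂x` are orthogonal and have the same length. -/
def ConformalMetric.hilbertSchmidtSq (g : ConformalMetric M)
    (f : M → ℙ ℂ (EuclideanSpace ℂ (Fin N))) (x : M) : ℝ :=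
  projDerivNormSq f x (tangentOne x) / g.normSq x (tangentOne x) +
    projDerivNormSq f x (tangentJ (tangentOne x)) / g.normSq x (tangentJ (tangentOne x))

variable [T2Space M] [CompactSpace M]

/-- The energy `E(f) = 1/2 ∫_M |df|^2 dv_g`. -/
def ConformalMetric.energy (g : ConformalMetric M) (f : M → ℙ ℂ (EuclideanSpace ℂ (Fin N))) : ℝ :=
  1 / 2 * g.integral (g.hilbertSchmidtSq f)

/-- Harmonic maps are the smooth critical points of the energy: for every smooth variation
`Φ_t`, `|t| < ε`, of `f` the derivative of `E(Φ_t)` at `t = 0` exists and vanishes. -/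
def ConformalMetric.IsHarmonic (g : ConformalMetric M)
    (f : M → ℙ ℂ (EuclideanSpace ℂ (Fin N))) : Prop :=
  (∀ x, ProjSmoothAt 𝓘(ℝ, ℂ) f x) ∧
    ∀ (ε : ℝ) (Φ : ℝ → M → ℙ ℂ (EuclideanSpace ℂ (Fin N))), 0 < ε →
      (∀ t x, |t| < ε → ProjSmoothAt (𝓘(ℝ, ℝ).prod 𝓘(ℝ, ℂ))
        (fun q : ℝ × M => Φ q.1 q.2) (t, x)) →
      Φ 0 = f →
      HasDerivAt (fun t => g.energy (Φ t)) 0 0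

end Projective

/-! ## Spin structures, spinors and the Dirac operator -/

/-- The complex conjugate of a complex vector space: the same additive group, on which the scalar
`c` acts as its conjugate did. -/
def ConjSpace (V : Type*) : Type _ := V

namespace ConjSpace

variable {V : Type*}

/-- The antilinear identification `v ↦ v̄` of `V` with its conjugate space. -/
def bar (v : V) : ConjSpace V := v

/-- The antilinear identification `v̄ ↦ v` of the conjugate space with `V`. -/
def unbar (v : ConjSpace V) : V := v

instance [AddCommGroup V] : AddCommGroup (ConjSpace V) := inferInstanceAs (AddCommGroup V)

instance [AddCommGroup V] [Module ℂ V] : Module ℂ (ConjSpace V) :=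
  Module.compHom V (starRingEnd ℂ)

end ConjSpace

section Spin

variable (M : Type*) [TopologicalSpace M] [ChartedSpace ℂ M] [IsManifold 𝓘(ℂ) ω M]
  (S : M → Type*) [∀ x, AddCommGroup (S x)] [∀ x, Module ℂ (S x)]
  [∀ x, TopologicalSpace (S x)] [TopologicalSpace (TotalSpace ℂ S)] [FiberBundle ℂ S]

/-- A spin structure: an isomorphism `S ⊗ S ≅ K` with the canonical bundle `K = (T^{(1,0)}M)^*` that
is holomorphic, i.e. maps products of local holomorphic sections of the holomorphic line bundle
`S` to local holomorphic sections of `K`. -/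
structure SpinStructure [VectorBundle ℂ ℂ S] [ContMDiffVectorBundle ω ℂ S 𝓘(ℂ)] where
  /-- The isomorphism on the fibres. -/
  iso (x : M) : (S x ⊗[ℂ] S x) ≃ₗ[ℂ] (TangentSpace 𝓘(ℂ) x →L[ℂ] ℂ)
  /-- The isomorphism is holomorphic. -/
  holomorphic (s t : ∀ x, S x) (x₀ : M) :
    ContMDiffAt 𝓘(ℂ) (𝓘(ℂ).prod 𝓘(ℂ)) ω (fun x => TotalSpace.mk' ℂ x (s x)) x₀ →
    ContMDiffAt 𝓘(ℂ) (𝓘(ℂ).prod 𝓘(ℂ)) ω (fun x => TotalSpace.mk' ℂ x (t x)) x₀ →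
    ContMDiffAt 𝓘(ℂ) (𝓘(ℂ).prod 𝓘(ℂ, ℂ →L[ℂ] ℂ)) ω
      (fun x => TotalSpace.mk' (ℂ →L[ℂ] ℂ)
        (E := fun y : M => (TangentSpace 𝓘(ℂ) y →L[ℂ] ℂ)) x (iso x (s x ⊗ₜ[ℂ] t x))) x₀

/-- A spinor field `ψ = (ψ₊, ψ₋)`: a smooth section of the spinor bundle `S ⊕ S̄`. -/
structure Spinor where
  /-- The component `ψ₊`, a section of `S`. -/
  plus (x : M) : S x
  /-- The component `ψ₋`, a section of `S̄`. -/
  minus (x : M) : ConjSpace (S x)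
  /-- `ψ₊` is smooth. -/
  smooth_plus : ContMDiff 𝓘(ℝ, ℂ) (𝓘(ℝ, ℂ).prod 𝓘(ℝ, ℂ)) ∞
    (fun x => TotalSpace.mk' ℂ x (plus x))
  /-- `ψ₋` is smooth. -/
  smooth_minus : ContMDiff 𝓘(ℝ, ℂ) (𝓘(ℝ, ℂ).prod 𝓘(ℝ, ℂ)) ∞
    (fun x => TotalSpace.mk' ℂ x (minus x).unbar)

variable {M} {S} [VectorBundle ℂ ℂ S] [ContMDiffVectorBundle ω ℂ S 𝓘(ℂ)]

namespace SpinStructure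

variable (σ : SpinStructure M S) (g : ConformalMetric M)

/-- The coefficient `a` in `s ⊗ s = a dz`, for the preferred chart `z` at `x`. -/
def sqCoeff (x : M) (s : S x) : ℂ := σ.iso x (s ⊗ₜ[ℂ] s) (1 : ℂ)

/-- The Hermitian metric on `S` induced by `g`: `|s|^2 = |s ⊗ s|`, where `|a dz| = |a| e^{-ω}` if
`g = e^{2ω} (dx^2 + dy^2)`. -/
def normSq (x : M) (s : S x) : ℝ :=
  ‖σ.sqCoeff x s‖ / √(g.normSq x (tangentOne x))

/-- `|ψ|^2 = |ψ₊|^2 + |ψ₋|^2`. -/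
def spinorNormSq (ψ : Spinor M S) (x : M) : ℝ :=
  σ.normSq g x (ψ.plus x) + σ.normSq g x (ψ.minus x).unbar

/-- The holomorphic local frame of `S` given by the preferred trivialization at `x₀`. -/
def frame (x₀ x : M) : S x := (trivializationAt ℂ S x₀).symm x (1 : ℂ)

/-- The function `f` with `s = f e` near `x₀`, where `e` is the holomorphic frame at `x₀`. -/
def frameCoeff (s : ∀ x, S x) (x₀ x : M) : ℂ := (trivializationAt ℂ S x₀ ⟨x, s x⟩).2

/-- `∂f/∂z̄ = (∂f/∂x + i ∂f/∂y) / 2` at `x`, for the preferred chart `z` at `x`. -/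
def dzbar (f : M → ℂ) (x : M) : ℂ :=
  let fx : ℂ := mfderiv 𝓘(ℝ, ℂ) 𝓘(ℝ, ℂ) f x (tangentOne x)
  let fy : ℂ := mfderiv 𝓘(ℝ, ℂ) 𝓘(ℝ, ℂ) f x (tangentJ (tangentOne x))
  (fx + Complex.I * fy) / 2

/-- The operator `∂̄_g : Γ(S) → Γ(S ⊗ K̄) → Γ(S̄)`. For a holomorphic frame `e` with
`e ⊗ e = a dz` one has `dz̄ = ē ⊗ ē / ā`, so `∂̄(f e) = (∂f/∂z̄) e ⊗ dz̄` is mapped to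
`|e|^2 (∂f/∂z̄) / ā • ē`. If `a = 1` this is the formula `∂̄_g(f s₀) = |s₀|^2 (∂f/∂z̄) s̄₀`. -/
def dbar (s : ∀ x, S x) (x : M) : ConjSpace (S x) :=
  ((σ.normSq g x (frame x x) : ℂ) * dzbar (frameCoeff s x) x /
    (starRingEnd ℂ) (σ.sqCoeff x (frame x x))) • ConjSpace.bar (frame x x : S x)

/-- The operator `∂_g : Γ(S̄) → Γ(S)`, the complex conjugate of `∂̄_g`. For `s₀ ⊗ s₀ = dz` it is
given by `∂_g(f s̄₀) = |s₀|^2 (∂f/∂z) s₀`. -/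
def del (s : ∀ x, ConjSpace (S x)) (x : M) : S x :=
  (σ.dbar g (fun y => (s y).unbar) x).unbar

/-- The Dirac operator `D(ψ₊, ψ₋) = 2 (∂_g ψ₋, -∂̄_g ψ₊)`. -/
def dirac (ψ : Spinor M S) (x : M) : S x × ConjSpace (S x) :=
  (2 : ℂ) • (σ.del g ψ.minus x, -σ.dbar g ψ.plus x)

end SpinStructure

variable {m : ℕ}

/-- The coordinates `(ψ₁₊, ψ̄₁₋, …, ψₘ₊, ψ̄ₘ₋)` at the point `x`, which are elements of the line
`S x`. -/
def spinorCoord (ψ : Fin m → Spinor M S) (x : M) (k : Fin (2 * m)) : S x :=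
  if k.val % 2 = 0 then (ψ ⟨k.val / 2, by omega⟩).plus x
  else ((ψ ⟨k.val / 2, by omega⟩).minus x).unbar

/-- The same coordinates, as a vector in `ℂ^{2m}`, with respect to the frame of the line `S x` given
by the preferred trivialization at `x`. -/
def spinorVec (ψ : Fin m → Spinor M S) (x : M) : EuclideanSpace ℂ (Fin (2 * m)) :=
  WithLp.toLp 2 fun k => (trivializationAt ℂ S x ⟨x, spinorCoord ψ x k⟩).2

/-- Spinors with `Σ |ψ_j|^2 = 1` have no common zero. -/
theorem spinorVec_ne_zero (σ : SpinStructure M S) (g : ConformalMetric M)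
    (ψ : Fin m → Spinor M S) (h : ∀ x, ∑ j, σ.spinorNormSq g (ψ j) x = 1) (x : M) :
    spinorVec ψ x ≠ 0 := by
  intro h0
  have hc : ∀ k, spinorCoord ψ x k = 0 := by
    intro k
    have hk : (trivializationAt ℂ S x ⟨x, spinorCoord ψ x k⟩).2 = 0 := congrArg (fun v => v k) h0
    have hx := FiberBundle.mem_baseSet_trivializationAt ℂ S x
    apply ((trivializationAt ℂ S x).continuousLinearEquivAt ℂ x hx).injective
    rw [map_zero]
    simpa using hk
  have hp : ∀ j, (ψ j).plus x = 0 := by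
    intro j
    have := hc ⟨2 * j.val, by omega⟩
    simpa [spinorCoord] using this
  have hm : ∀ j, ((ψ j).minus x).unbar = 0 := by
    intro j
    have := hc ⟨2 * j.val + 1, by omega⟩
    have e : (2 * j.val + 1) / 2 = j.val := by omega
    simpa [spinorCoord, Nat.add_mod, e] using this
  have hz : σ.sqCoeff x (0 : S x) = 0 := by
    unfold SpinStructure.sqCoeff
    rw [TensorProduct.zero_tmul, map_zero]
    rfl
  have := h x
  simp [SpinStructure.spinorNormSq, SpinStructure.normSq, hp, hm, hz] at this

/-- The map `[ψ₁₊ : ψ̄₁₋ : … : ψₘ₊ : ψ̄ₘ₋] : M → ℂP^{2m-1}`. As the coordinates at `x` lie in a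
line, the point does not depend on the frame of that line used to express them. -/
def spinorMap (ψ : Fin m → Spinor M S) (h : ∀ x, spinorVec ψ x ≠ 0) (x : M) :
    ℙ ℂ (EuclideanSpace ℂ (Fin (2 * m))) :=
  Projectivization.mk ℂ (spinorVec ψ x) (h x)

end Spin

end

set_option linter.unusedSectionVars false

noncomputable section

/-! ## The embedding of projective space by rank one projections -/

section RankOne

variable {N : ℕ}

/-! A line in `ℂ^N` is identified with its orthogonal projection. This embeds `ℂP^{N-1}` in the
Euclidean space of matrices, where the metric `4 g_FS` is twice the induced one, so the energy
becomes a Dirichlet integral (`hilbertSchmidtSq_eq`). Conformal invariance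
(`gradInner_mul_chartDensity`), a partition of unity and integration by parts then reduce
harmonicity to a pointwise condition: in each chart the flat Laplacian of the projection is
orthogonal to the tangent space of projective space (`isHarmonic_of_laplacian`).

Let `F` be the vector of spinor coordinates in a holomorphic frame `e` of `S`, with `e ⊗ e = a dz`.
The Dirac equation expresses `∂F/∂z̄` through `J F`, where `J` is the quaternionic structure
`quatJ`, with the metric entering only as a factor `|e|^{-2}`. The normalization says `|e|²|F|² =
1`, so the metric drops out and `2 ∂F/∂z̄ = |F|² G` with `G = λ ā J F` (`planeDbar_spinorFrameVec`).
Moreover `G ⊥ F`, because `⟨F, J F⟩` is an alternating expression. Finally `∂G/∂z ∈ ℂ F`, because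
`a` is holomorphic, `J` is antilinear and `J² = -1`.

These three facts suffice (`inner_planeLaplacian_rankOneProj`). For fixed `v ∈ ℂ F(z)` and `w ⊥
F(z)`, the component of the projection along `w v^* + v w^*` is `2 Re (k h)` with `k = ⟨w, F⟩` and
`h = ⟨F, v⟩ / |F|²`. The factor `|F|²` in the equation for `F` cancels the denominator of `h`, and
each of the four terms of `∂∂̄ (k h)` vanishes at `z`. -/

/-- The matrix `u v^*`, as a vector with the Frobenius norm. -/
def rankOne (u v : EuclideanSpace ℂ (Fin N)) : EuclideanSpace ℂ (Fin N × Fin N) :=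
  WithLp.toLp 2 fun k => u k.1 * (starRingEnd ℂ) (v k.2)

@[simp] lemma rankOne_apply (u v : EuclideanSpace ℂ (Fin N)) (k : Fin N × Fin N) :
    rankOne u v k = u k.1 * (starRingEnd ℂ) (v k.2) := rfl

lemma inner_rankOne (u v u' v' : EuclideanSpace ℂ (Fin N)) :
    inner ℂ (rankOne u v) (rankOne u' v') = inner ℂ u u' * inner ℂ v' v := by
  simp only [PiLp.inner_apply, rankOne_apply, RCLike.inner_apply, Fintype.sum_prod_type,
    Finset.sum_mul_sum, map_mul, RingHomCompTriple.comp_apply, RingHom.id_apply]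
  refine Finset.sum_congr rfl fun i _ => Finset.sum_congr rfl fun j _ => ?_
  ring

lemma norm_rankOne (u v : EuclideanSpace ℂ (Fin N)) : ‖rankOne u v‖ = ‖u‖ * ‖v‖ := by
  have h := inner_rankOne u v u v
  rw [inner_self_eq_norm_sq_to_K, inner_self_eq_norm_sq_to_K, inner_self_eq_norm_sq_to_K] at h
  have h' : ‖rankOne u v‖ ^ 2 = (‖u‖ * ‖v‖) ^ 2 := by
    rw [mul_pow]; exact_mod_cast h
  exact (sq_eq_sq₀ (norm_nonneg _) (by positivity)).1 h'

lemma isBoundedBilinearMap_rankOne :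
    IsBoundedBilinearMap ℝ (fun p : EuclideanSpace ℂ (Fin N) × EuclideanSpace ℂ (Fin N) =>
      rankOne p.1 p.2) where
  add_left u u' v := by ext k; simp [add_mul]
  smul_left c u v := by ext k; simp [mul_assoc]
  add_right u v v' := by ext k; simp [mul_add]
  smul_right c u v := by ext k; simp; ring
  bound := ⟨1, one_pos, fun u v => by rw [norm_rankOne, one_mul]⟩

lemma rankOne_smul_smul (c : ℂ) (u v : EuclideanSpace ℂ (Fin N)) :
    rankOne (c • u) (c • v) = (‖c‖ ^ 2) • rankOne u v := by
  ext k
  have : (c * (starRingEnd ℂ) c) = ((‖c‖ ^ 2 : ℝ) : ℂ) := by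
    rw [Complex.mul_conj, Complex.normSq_eq_norm_sq]
  simp only [rankOne_apply, PiLp.smul_apply, smul_eq_mul, map_mul, Complex.real_smul, ← this]
  ring

/-- The orthogonal projection onto the line spanned by `u`. -/
def rankOneProj (u : EuclideanSpace ℂ (Fin N)) : EuclideanSpace ℂ (Fin N × Fin N) :=
  (‖u‖ ^ 2)⁻¹ • rankOne u u

lemma rankOneProj_smul {c : ℂ} (hc : c ≠ 0) (u : EuclideanSpace ℂ (Fin N)) :
    rankOneProj (c • u) = rankOneProj u := by
  have : ‖c‖ ^ 2 ≠ 0 := by positivity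
  rw [rankOneProj, rankOneProj, rankOne_smul_smul, smul_smul, norm_smul, mul_pow, mul_inv,
    mul_right_comm, inv_mul_cancel₀ this, one_mul]

/-- The orthogonal projection onto a point of projective space. -/
def lineProj (p : ℙ ℂ (EuclideanSpace ℂ (Fin N))) : EuclideanSpace ℂ (Fin N × Fin N) :=
  rankOneProj p.rep

/-- The representative `rep` is an arbitrary choice. Formulas that contain it are made independent
of it by tracking this scalar. -/
lemma rep_mk_eq {u : EuclideanSpace ℂ (Fin N)} (hu : u ≠ 0) :
    ∃ c : ℂ, c ≠ 0 ∧ (Projectivization.mk ℂ u hu).rep = c • u := by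
  obtain ⟨a, ha⟩ := Projectivization.exists_smul_eq_mk_rep ℂ u hu
  exact ⟨a, a.ne_zero, ha.symm⟩

lemma lineProj_mk {u : EuclideanSpace ℂ (Fin N)} (hu : u ≠ 0) :
    lineProj (Projectivization.mk ℂ u hu) = rankOneProj u := by
  obtain ⟨c, hc, h⟩ := rep_mk_eq hu
  rw [lineProj, h, rankOneProj_smul hc]

lemma projChart_mk (p : ℙ ℂ (EuclideanSpace ℂ (Fin N))) {u : EuclideanSpace ℂ (Fin N)}
    (hu : u ≠ 0) :
    projChart p (Projectivization.mk ℂ u hu) =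
      ((‖p.rep‖ ^ 2 : ℂ) / inner ℂ p.rep u) • u - p.rep := by
  obtain ⟨c, hc, h⟩ := rep_mk_eq hu
  rw [projChart, h, inner_smul_right, smul_smul]
  congr 2
  by_cases h0 : inner ℂ p.rep u = 0
  -- Outside the affine chart both quotients have denominator zero, hence are zero by convention.
  · simp [h0]
  · field_simp

lemma contDiffAt_rankOneProj {u : EuclideanSpace ℂ (Fin N)} (hu : u ≠ 0) :
    ContDiffAt ℝ ∞ (rankOneProj (N := N)) u := by
  have h1 : ContDiffAt ℝ ∞ (fun u : EuclideanSpace ℂ (Fin N) => (‖u‖ ^ 2)⁻¹) u :=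
    (contDiff_norm_sq ℝ).contDiffAt.inv (by positivity)
  have h2 : ContDiffAt ℝ ∞ (fun u : EuclideanSpace ℂ (Fin N) => rankOne u u) u :=
    (isBoundedBilinearMap_rankOne.contDiff.comp (contDiff_id.prodMk contDiff_id)).contDiffAt
  exact h1.smul h2

lemma euclidean_real_inner_eq_re {ι : Type*} [Fintype ι] (u v : EuclideanSpace ℂ ι) :
    inner ℝ u v = (inner ℂ u v).re := by
  simp [PiLp.inner_apply]

/-- The derivative of the factor `‖u‖⁻²` is proportional to `Re ⟨v, w⟩ = 0`, so only the product
rule for `u u^*` contributes. -/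
lemma fderiv_rankOneProj {v : EuclideanSpace ℂ (Fin N)} (hv : v ≠ 0)
    {w : EuclideanSpace ℂ (Fin N)} (hw : inner ℂ v w = 0) :
    fderiv ℝ (rankOneProj (N := N)) v w = (‖v‖ ^ 2)⁻¹ • (rankOne w v + rankOne v w) := by
  have hb := (isBoundedBilinearMap_rankOne (N := N)).hasFDerivAt (v, v)
  have h2 : HasFDerivAt (fun u : EuclideanSpace ℂ (Fin N) => rankOne u u) _ v :=
    HasFDerivAt.comp (f := fun u : EuclideanSpace ℂ (Fin N) => (u, u)) v hb
      ((hasFDerivAt_id v).prodMk (hasFDerivAt_id v))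
  have h1 := (hasDerivAt_inv (by positivity : ‖v‖ ^ 2 ≠ 0)).comp_hasFDerivAt v
    (hasStrictFDerivAt_norm_sq v).hasFDerivAt
  have h3 := h1.smul h2
  have h4 : fderiv ℝ (rankOneProj (N := N)) v = _ := h3.fderiv
  have hre : inner ℝ v w = 0 := by
    rw [euclidean_real_inner_eq_re, hw, Complex.zero_re]
  rw [h4]
  simp [hre, IsBoundedBilinearMap.deriv_apply, add_comm]

end RankOne

/-! ### Differentials of smooth maps into projective space -/

section Smooth

variable {N : ℕ} {E H X : Type*} [NormedAddCommGroup E] [NormedSpace ℝ E] [TopologicalSpace H]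
    {J : ModelWithCorners ℝ E H} [TopologicalSpace X] [ChartedSpace H X]
    {f : X → ℙ ℂ (EuclideanSpace ℂ (Fin N))} {x : X}

lemma ProjSmoothAt.contMDiffAt_lineProj (hf : ProjSmoothAt J f x) :
    ContMDiffAt J 𝓘(ℝ, EuclideanSpace ℂ (Fin N × Fin N)) ∞ (fun y => lineProj (f y)) x := by
  obtain ⟨F, hF, h⟩ := hf
  have h0 : F x ≠ 0 := h.self_of_nhds.choose
  have := (contDiffAt_rankOneProj h0).contMDiffAt.comp x hF
  refine this.congr_of_eventuallyEq ?_
  filter_upwards [h] with y hy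
  obtain ⟨h1, h2⟩ := hy
  simp [h2, lineProj_mk]

lemma ProjSmoothAt.contMDiffAt_projChart (hf : ProjSmoothAt J f x) :
    ContMDiffAt J 𝓘(ℝ, EuclideanSpace ℂ (Fin N)) ∞ (fun y => projChart (f x) (f y)) x := by
  obtain ⟨F, hF, h⟩ := hf
  obtain ⟨h0, hx⟩ := h.self_of_nhds
  obtain ⟨c, hc, hr⟩ := rep_mk_eq h0
  rw [← hx] at hr
  have hi : inner ℂ (f x).rep (F x) ≠ 0 := by
    rw [hr, inner_smul_left]
    simp [hc, h0]
  have key : ContDiffAt ℝ ∞ (fun u : EuclideanSpace ℂ (Fin N) =>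
      ((‖(f x).rep‖ ^ 2 : ℂ) / inner ℂ (f x).rep u) • u - (f x).rep) (F x) := by
    have h1 : ContDiffAt ℝ ∞ (fun u : EuclideanSpace ℂ (Fin N) => inner ℂ (f x).rep u) (F x) :=
      ((innerSL ℂ (f x).rep).restrictScalars ℝ).contDiff.contDiffAt
    simp only [div_eq_mul_inv]
    exact ((contDiffAt_const.mul (h1.inv hi)).smul contDiffAt_id).sub contDiffAt_const
  have := key.contMDiffAt.comp x hF
  refine this.congr_of_eventuallyEq ?_
  filter_upwards [h] with y hy
  obtain ⟨h1, h2⟩ := hy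
  simp [h2, projChart_mk]

/-- The differential of a smooth map into projective space, in the affine chart and after
composition with the embedding by projections. -/
lemma ProjSmoothAt.mfderiv_lineProj (hf : ProjSmoothAt J f x) (ξ : TangentSpace J x) :
    ∃ w : EuclideanSpace ℂ (Fin N), 
      mfderiv J 𝓘(ℝ, EuclideanSpace ℂ (Fin N)) (fun y => projChart (f x) (f y)) x ξ = w ∧
      inner ℂ (f x).rep w = 0 ∧
      mfderiv J 𝓘(ℝ, EuclideanSpace ℂ (Fin N × Fin N)) (fun y => lineProj (f y)) x ξ =
        (‖(f x).rep‖ ^ 2)⁻¹ • (rankOne w (f x).rep + rankOne (f x).rep w) := by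
  have hW := (hf.contMDiffAt_projChart.mdifferentiableAt (by simp)).hasMFDerivAt
  set v := (f x).rep with hv
  have hv0 : v ≠ 0 := (f x).rep_nonzero
  set W' := mfderiv J 𝓘(ℝ, EuclideanSpace ℂ (Fin N)) (fun y => projChart (f x) (f y)) x
  obtain ⟨F, hF, h⟩ := hf
  obtain ⟨h0, hx⟩ := h.self_of_nhds
  obtain ⟨c, hc, hr⟩ := rep_mk_eq h0
  rw [← hx, ← hv] at hr
  have hi : inner ℂ v (F x) ≠ 0 := by
    rw [hr, inner_smul_left]
    simp [hc, h0]
  have hev : ∀ᶠ y in 𝓝 x, inner ℂ v (F y) ≠ 0 :=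
    (continuous_const.inner continuous_id).continuousAt.comp hF.continuousAt |>.eventually_ne hi
  -- Near `x` the affine chart takes values in `v^⊥`, so its derivative does too.
  have horth : inner ℂ v (W' ξ : EuclideanSpace ℂ (Fin N)) = 0 := by
    have hc := (((innerSL ℂ v).restrictScalars ℝ).hasFDerivAt
      (x := projChart (f x) (f x))).hasMFDerivAt.comp x hW
    have hconst : HasMFDerivAt J 𝓘(ℝ, ℂ)
      (((innerSL ℂ v).restrictScalars ℝ) ∘ (fun y => projChart (f x) (f y))) x 0 := by
      refine (hasMFDerivAt_const (0 : ℂ) x).congr_of_eventuallyEq ?_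
      filter_upwards [h, hev] with y hy hy'
      obtain ⟨h1, h2⟩ := hy
      simp only [Function.comp_apply, h2, projChart_mk, ← hv]
      simp [inner_sub_right, inner_smul_right, hy', inner_self_eq_norm_sq_to_K]
    have := hasMFDerivAt_unique hc hconst
    exact congrArg (fun L : TangentSpace J x →L[ℝ] ℂ => L ξ) this
  refine ⟨W' ξ, rfl, horth, ?_⟩
  have hxx : projChart (f x) (f x) + v = v := by
    have : projChart (f x) (f x) = 0 := by
      rw [projChart, ← hv, inner_self_eq_norm_sq_to_K]
      have : (‖v‖ : ℂ) ^ 2 ≠ 0 := by simpa using hv0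
      simp [this]
    rw [this, zero_add]
  have hd : HasFDerivAt (fun u => rankOneProj (u + v)) (fderiv ℝ (rankOneProj (N := N)) v)
      (projChart (f x) (f x)) := by
    rw [hasFDerivAt_comp_add_right, hxx]
    exact ((contDiffAt_rankOneProj hv0).differentiableAt (by simp)).hasFDerivAt
  have hcomp := hd.hasMFDerivAt.comp x hW
  -- Adding `v` to the chart value gives a nonzero multiple of `F y`, which spans the same line.
  have heq : HasMFDerivAt J 𝓘(ℝ, EuclideanSpace ℂ (Fin N × Fin N)) (fun y => lineProj (f y)) x
      ((fderiv ℝ rankOneProj v).comp W') := by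
    refine hcomp.congr_of_eventuallyEq ?_
    filter_upwards [h, hev] with y hy hy'
    obtain ⟨h1, h2⟩ := hy
    simp only [Function.comp_apply, h2, projChart_mk, ← hv, lineProj_mk, sub_add_cancel]
    rw [rankOneProj_smul]
    have : (‖v‖ : ℂ) ^ 2 ≠ 0 := by simpa using hv0
    exact div_ne_zero this hy'
  rw [heq.mfderiv]
  exact fderiv_rankOneProj hv0 horth

/-- The two summands are orthogonal, with Frobenius product `⟨w, v⟩² = 0`, and have equal length. -/
lemma norm_sq_rankOne_add {v w : EuclideanSpace ℂ (Fin N)} (h : inner ℂ v w = 0) :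
    ‖rankOne w v + rankOne v w‖ ^ 2 = 2 * ‖v‖ ^ 2 * ‖w‖ ^ 2 := by
  rw [@norm_add_sq ℂ, inner_rankOne, norm_rankOne, norm_rankOne, inner_eq_zero_symm.1 h]
  simp; ring

end Smooth

/-! ## Calculus in the charts of a Riemann surface -/

section ChartCalculus

open Set MeasureTheory

lemma HasMFDerivAt.restrictScalars_complex {X Y : Type*} [TopologicalSpace X] [ChartedSpace ℂ X]
    [TopologicalSpace Y] [ChartedSpace ℂ Y] {h : X → Y} {x : X}
    {L : ℂ →L[ℂ] ℂ} (hL : HasMFDerivAt 𝓘(ℂ) 𝓘(ℂ) h x L) :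
    HasMFDerivAt 𝓘(ℝ, ℂ) 𝓘(ℝ, ℂ) h x (L.restrictScalars ℝ : ℂ →L[ℝ] ℂ) := by
  refine ⟨hL.1, ?_⟩
  have := hL.2
  exact HasFDerivWithinAt.restrictScalars ℝ this

variable {M : Type*} [TopologicalSpace M] [ChartedSpace ℂ M]

/-- The coordinate vector field `∂/∂x` of a chart, expressed in the preferred chart. -/
def chartVelocity (φ : OpenPartialHomeomorph M ℂ) (z : ℂ) : ℂ :=
  mfderiv 𝓘(ℝ, ℂ) 𝓘(ℝ, ℂ) φ.symm z (1 : ℂ)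

variable [IsManifold 𝓘(ℂ) ω M] {V : Type*} [NormedAddCommGroup V] [InnerProductSpace ℝ V]

/-- The differential of a map into a vector space, as a linear map in the preferred coordinate. -/
def surfaceDeriv {V : Type*} [NormedAddCommGroup V] [NormedSpace ℝ V] (P : M → V) (x : M) :
    ℂ →L[ℝ] V :=
  mfderiv 𝓘(ℝ, ℂ) 𝓘(ℝ, V) P x

lemma mdifferentiableAt_chartAt_symm (i : M) {z : ℂ} (hz : z ∈ (chartAt ℂ i).target) :
    MDifferentiableAt 𝓘(ℂ) 𝓘(ℂ) (chartAt ℂ i).symm z := by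
  have := (contMDiffOn_chart_symm (I := 𝓘(ℂ)) (x := i) (n := ω)).contMDiffAt
    ((chartAt ℂ i).open_target.mem_nhds hz)
  exact this.mdifferentiableAt (by simp)

lemma contMDiffAt_chartAt_symm (i : M) {z : ℂ} (hz : z ∈ (chartAt ℂ i).target) :
    ContMDiffAt 𝓘(ℝ, ℂ) 𝓘(ℝ, ℂ) ∞ (chartAt ℂ i).symm z :=
  ((contMDiffOn_chart_symm (I := 𝓘(ℝ, ℂ)) (x := i) (n := ω)).contMDiffAt
    ((chartAt ℂ i).open_target.mem_nhds hz)).of_le (by simp)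

/-- Inverse charts are holomorphic, so their real differential is multiplication by a complex
number. Conformal invariance rests on this. -/
lemma hasMFDerivAt_chartAt_symm (i : M) {z : ℂ} (hz : z ∈ (chartAt ℂ i).target) :
    HasMFDerivAt 𝓘(ℝ, ℂ) 𝓘(ℝ, ℂ) (chartAt ℂ i).symm z
      (ContinuousLinearMap.restrictScalars ℝ (ContinuousLinearMap.toSpanSingleton ℂ
        (chartVelocity (chartAt ℂ i) z)) : ℂ →L[ℝ] ℂ) := by
  obtain ⟨L, hL⟩ : ∃ L : ℂ →L[ℂ] ℂ, HasMFDerivAt 𝓘(ℂ) 𝓘(ℂ) (chartAt ℂ i).symm z L :=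
    ⟨_, (mdifferentiableAt_chartAt_symm i hz).hasMFDerivAt⟩
  have h' := hL.restrictScalars_complex
  have hv : chartVelocity (chartAt ℂ i) z = L 1 := by
    rw [chartVelocity, h'.mfderiv]; rfl
  have hs : ContinuousLinearMap.toSpanSingleton ℂ (L 1) = L := by ext; simp
  rw [hv, hs]
  exact h'

lemma fderiv_comp_chartAt_symm (i : M) {z : ℂ} (hz : z ∈ (chartAt ℂ i).target) {P : M → V}
    (hP : MDifferentiableAt 𝓘(ℝ, ℂ) 𝓘(ℝ, V) P ((chartAt ℂ i).symm z)) (v : ℂ) :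
    fderiv ℝ (fun w => P ((chartAt ℂ i).symm w)) z v =
      surfaceDeriv P ((chartAt ℂ i).symm z) (v * chartVelocity (chartAt ℂ i) z) := by
  have h : HasFDerivAt (fun w => P ((chartAt ℂ i).symm w))
      ((surfaceDeriv P ((chartAt ℂ i).symm z)).comp
        (ContinuousLinearMap.restrictScalars ℝ (ContinuousLinearMap.toSpanSingleton ℂ
          (chartVelocity (chartAt ℂ i) z)))) z := by
    have h1 := hP.hasMFDerivAt.comp z (hasMFDerivAt_chartAt_symm i hz)
    exact hasMFDerivAt_iff_hasFDerivAt.1 h1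
  rw [h.fderiv]
  rfl

namespace ConformalMetric

variable (g : ConformalMetric M)

/-- Invariance under `J` makes `e` and `J e` equally long. It also gives `g(e, J e) = g(J e, -e)`,
so they are orthogonal by symmetry. -/
lemma normSq_eq (x : M) (c : ℂ) :
    g.normSq x (c : ℂ) = ‖c‖ ^ 2 * g.normSq x (tangentOne x) := by
  set e : TangentSpace 𝓘(ℝ, ℂ) x := tangentOne x with he
  have hJJ : tangentJ (tangentJ e) = -e := by
    change Complex.I * (Complex.I * (1 : ℂ)) = -(1 : ℂ)
    simp
  have h1 : g.inner x (tangentJ e) (tangentJ e) = g.inner x e e := g.conformal x e e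
  have h2 : g.inner x e (tangentJ e) = 0 := by
    have h := g.conformal x e (tangentJ e)
    rw [hJJ, map_neg, g.symm x] at h
    linarith
  have h3 : g.inner x (tangentJ e) e = 0 := by rw [g.symm x, h2]
  have hc : (c : TangentSpace 𝓘(ℝ, ℂ) x) = c.re • e + c.im • tangentJ e := by
    change c = (c.re : ℝ) • (1 : ℂ) + (c.im : ℝ) • (Complex.I * (1 : ℂ))
    apply Complex.ext <;> simp
  have hn : ‖c‖ ^ 2 = c.re ^ 2 + c.im ^ 2 := by
    rw [← Complex.normSq_eq_norm_sq, Complex.normSq_apply]; ring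
  rw [hn]
  generalize c.re = a, c.im = b at hc ⊢
  simp only [normSq]
  rw [hc]
  simp only [map_add, map_smul, add_apply, smul_apply,
    h1, h2, h3, smul_eq_mul]
  ring

lemma normSq_tangentOne_pos (x : M) : 0 < g.normSq x (tangentOne x) :=
  g.pos x _ (by change (1 : ℂ) ≠ 0; exact one_ne_zero)

lemma chartDensity_eq (φ : OpenPartialHomeomorph M ℂ) (z : ℂ) :
    g.chartDensity φ z = ‖chartVelocity φ z‖ ^ 2 * g.normSq (φ.symm z) (tangentOne _) :=
  g.normSq_eq _ (chartVelocity φ z)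

/-- The pointwise inner product `⟨dP, dA⟩_g` of the differentials of two maps into a Euclidean
space. -/
def gradInner (P A : M → V) (x : M) : ℝ :=
  (inner ℝ (surfaceDeriv P x 1) (surfaceDeriv A x 1) +
    inner ℝ (surfaceDeriv P x Complex.I) (surfaceDeriv A x Complex.I)) / g.normSq x (tangentOne x)

end ConformalMetric

/-- The inner product `⟨dp, da⟩` of the differentials of two maps on the plane. -/
def planeGradInner (p a : ℂ → V) (z : ℂ) : ℝ :=
  inner ℝ (fderiv ℝ p z 1) (fderiv ℝ a z 1) +
    inner ℝ (fderiv ℝ p z Complex.I) (fderiv ℝ a z Complex.I)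

/-- The pair `(c, I c)` is the orthonormal frame `(1, I)`, rotated and scaled by `‖c‖`, and the
trace does not see rotations. -/
lemma inner_map_mul_add (L L' : ℂ →L[ℝ] V) (c : ℂ) :
    inner ℝ (L c) (L' c) + inner ℝ (L (Complex.I * c)) (L' (Complex.I * c)) =
      ‖c‖ ^ 2 * (inner ℝ (L 1) (L' 1) + inner ℝ (L Complex.I) (L' Complex.I)) := by
  have hc : c = c.re • (1 : ℂ) + c.im • Complex.I := by apply Complex.ext <;> simp
  have hc' : Complex.I * c = (-c.im) • (1 : ℂ) + c.re • Complex.I := by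
    apply Complex.ext <;> simp
  have hn : ‖c‖ ^ 2 = c.re ^ 2 + c.im ^ 2 := by
    rw [← Complex.normSq_eq_norm_sq, Complex.normSq_apply]; ring
  rw [hc', hn]
  set a := c.re
  set b := c.im
  rw [hc]
  simp only [map_add, map_smul, inner_add_left, inner_add_right, real_inner_smul_left,
    real_inner_smul_right]
  ring

/-- Conformal invariance of the Dirichlet integrand in dimension two: the area density cancels the
factor by which `g` divides, and the flat expression in the chart remains. -/
lemma ConformalMetric.gradInner_mul_chartDensity (g : ConformalMetric M) (i : M) {z : ℂ}
    (hz : z ∈ (chartAt ℂ i).target) {P A : M → V}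
    (hP : MDifferentiableAt 𝓘(ℝ, ℂ) 𝓘(ℝ, V) P ((chartAt ℂ i).symm z))
    (hA : MDifferentiableAt 𝓘(ℝ, ℂ) 𝓘(ℝ, V) A ((chartAt ℂ i).symm z)) :
    g.gradInner P A ((chartAt ℂ i).symm z) * g.chartDensity (chartAt ℂ i) z =
      planeGradInner (fun w => P ((chartAt ℂ i).symm w)) (fun w => A ((chartAt ℂ i).symm w)) z := by
  have h0 := (g.normSq_tangentOne_pos ((chartAt ℂ i).symm z)).ne'
  rw [planeGradInner, fderiv_comp_chartAt_symm i hz hP, fderiv_comp_chartAt_symm i hz hA,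
    fderiv_comp_chartAt_symm i hz hP, fderiv_comp_chartAt_symm i hz hA, one_mul,
    inner_map_mul_add, g.chartDensity_eq, gradInner]
  field_simp

end ChartCalculus

/-! ## Integration on a compact Riemann surface -/

section Integration

open Set MeasureTheory

/-- A function which is continuous on an open set and vanishes outside a compact subset of it
is integrable on that set. -/
lemma integrableOn_of_continuousOn_of_compact {U K : Set ℂ} (hU : IsOpen U) (hK : IsCompact K)
    (hKU : K ⊆ U) {f : ℂ → ℝ} (hf : ContinuousOn f U) (h0 : ∀ z ∈ U, z ∉ K → f z = 0) :
    IntegrableOn f U := by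
  have h1 : IntegrableOn f K := (hf.mono hKU).integrableOn_compact hK
  exact h1.of_forall_sdiff_eq_zero hU.measurableSet fun z hz => h0 z hz.1 hz.2

lemma isCompact_image_chart {M : Type*} [TopologicalSpace M] [ChartedSpace ℂ M] {i : M}
    {K : Set M} (hK : IsCompact K)
    (hKi : K ⊆ (chartAt ℂ i).source) : IsCompact (chartAt ℂ i '' K) ∧
      chartAt ℂ i '' K ⊆ (chartAt ℂ i).target ∧
      ∀ z ∈ (chartAt ℂ i).target, z ∉ chartAt ℂ i '' K → (chartAt ℂ i).symm z ∉ K := by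
  refine ⟨hK.image_of_continuousOn ((chartAt ℂ i).continuousOn.mono hKi), ?_, ?_⟩
  · rintro _ ⟨x, hx, rfl⟩
    exact (chartAt ℂ i).map_source (hKi hx)
  · intro z hz h h'
    exact h ⟨_, h', (chartAt ℂ i).right_inv hz⟩

variable {M : Type*} [TopologicalSpace M] [ChartedSpace ℂ M] [IsManifold 𝓘(ℂ) ω M]

namespace ConformalMetric

variable (g : ConformalMetric M)

/-- The transition map between two charts is holomorphic and transforms the densities. -/
lemma chartDensity_transition (i k : M) {z : ℂ} (hz : z ∈ (chartAt ℂ i).target)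
    (hk : (chartAt ℂ i).symm z ∈ (chartAt ℂ k).source) :
    ∃ c : ℂ, HasDerivAt (fun w => chartAt ℂ k ((chartAt ℂ i).symm w)) c z ∧
      g.chartDensity (chartAt ℂ i) z =
        ‖c‖ ^ 2 * g.chartDensity (chartAt ℂ k) (chartAt ℂ k ((chartAt ℂ i).symm z)) := by
  have h1 := mdifferentiableAt_chartAt_symm i hz
  have h2 : MDifferentiableAt 𝓘(ℂ) 𝓘(ℂ) (chartAt ℂ k) ((chartAt ℂ i).symm z) :=
    ((contMDiffOn_chart (I := 𝓘(ℂ)) (x := k) (n := ω)).contMDiffAt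
      ((chartAt ℂ k).open_source.mem_nhds hk)).mdifferentiableAt (by simp)
  have h3 : DifferentiableAt ℂ (fun w => chartAt ℂ k ((chartAt ℂ i).symm w)) z :=
    mdifferentiableAt_iff_differentiableAt.1 (h2.comp z h1)
  refine ⟨_, h3.hasDerivAt, ?_⟩
  set τ := fun w => chartAt ℂ k ((chartAt ℂ i).symm w) with hτ
  have hkz : τ z ∈ (chartAt ℂ k).target := (chartAt ℂ k).map_source hk
  have hback : (chartAt ℂ k).symm (τ z) = (chartAt ℂ i).symm z := (chartAt ℂ k).left_inv hk
  have hv : chartVelocity (chartAt ℂ i) z = deriv τ z * chartVelocity (chartAt ℂ k) (τ z) := by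
    have e1 : HasMFDerivAt 𝓘(ℝ, ℂ) 𝓘(ℝ, ℂ) τ z
        (((ContinuousLinearMap.toSpanSingleton ℂ (deriv τ z)).restrictScalars ℝ : ℂ →L[ℝ] ℂ)) :=
      (h3.hasDerivAt.hasFDerivAt.restrictScalars ℝ).hasMFDerivAt
    have e2 := (hasMFDerivAt_chartAt_symm k hkz).comp z e1
    have e3 : (chartAt ℂ k).symm ∘ τ =ᶠ[𝓝 z] (chartAt ℂ i).symm := by
      have : (chartAt ℂ i).symm ⁻¹' (chartAt ℂ k).source ∈ 𝓝 z :=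
        ((chartAt ℂ i).continuousAt_symm hz).preimage_mem_nhds
          ((chartAt ℂ k).open_source.mem_nhds hk)
      filter_upwards [this] with w hw
      exact (chartAt ℂ k).left_inv hw
    have e4 := e2.congr_of_eventuallyEq e3.symm
    rw [chartVelocity, e4.mfderiv]
    change (1 * deriv τ z) * chartVelocity (chartAt ℂ k) (τ z) = _
    rw [one_mul]
  rw [g.chartDensity_eq, g.chartDensity_eq, hv, norm_mul, mul_pow, hback, mul_assoc]

/-- Change of variables along the transition map: the integrands live on the overlap, and the
Jacobian `‖c‖²` is the ratio of the densities. -/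
lemma integral_chart_eq (i k : M) {u : M → ℝ}
    (hu : ∀ x, u x ≠ 0 → x ∈ (chartAt ℂ i).source ∧ x ∈ (chartAt ℂ k).source) :
    ∫ z in (chartAt ℂ i).target, u ((chartAt ℂ i).symm z) * g.chartDensity (chartAt ℂ i) z =
      ∫ z in (chartAt ℂ k).target, u ((chartAt ℂ k).symm z) * g.chartDensity (chartAt ℂ k) z := by
  set T := (chartAt ℂ i).symm ≫ₕ (chartAt ℂ k) with hT
  have hTs : T.source = (chartAt ℂ i).target ∩ (chartAt ℂ i).symm ⁻¹' (chartAt ℂ k).source := by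
    simp [hT]
  have hTt : T.target = (chartAt ℂ k).target ∩ (chartAt ℂ k).symm ⁻¹' (chartAt ℂ i).source := by
    simp [hT]
  have hI : ∫ z in (chartAt ℂ i).target,
      u ((chartAt ℂ i).symm z) * g.chartDensity (chartAt ℂ i) z =
      ∫ z in T.source, u ((chartAt ℂ i).symm z) * g.chartDensity (chartAt ℂ i) z := by
    refine (setIntegral_eq_of_subset_of_forall_sdiff_eq_zero
      (chartAt ℂ i).open_target.measurableSet (hTs ▸ inter_subset_left) fun z hz => ?_)
    rw [hTs] at hz
    by_contra h
    exact hz.2 ⟨hz.1, (hu _ (left_ne_zero_of_mul h)).2⟩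
  have hK : ∫ z in (chartAt ℂ k).target,
      u ((chartAt ℂ k).symm z) * g.chartDensity (chartAt ℂ k) z =
      ∫ z in T.target, u ((chartAt ℂ k).symm z) * g.chartDensity (chartAt ℂ k) z := by
    refine (setIntegral_eq_of_subset_of_forall_sdiff_eq_zero
      (chartAt ℂ k).open_target.measurableSet (hTt ▸ inter_subset_left) fun z hz => ?_)
    rw [hTt] at hz
    by_contra h
    exact hz.2 ⟨hz.1, (hu _ (left_ne_zero_of_mul h)).1⟩
  rw [hI, hK]
  have hex : ∀ z ∈ T.source, ∃ c : ℂ, HasDerivAt T c z ∧ g.chartDensity (chartAt ℂ i) z =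
      ‖c‖ ^ 2 * g.chartDensity (chartAt ℂ k) (T z) := by
    intro z hz
    rw [hTs] at hz
    exact g.chartDensity_transition i k hz.1 hz.2
  choose! c hc hd using hex
  rw [← T.image_source_eq_target, integral_image_eq_integral_abs_det_fderiv_smul volume
    T.open_source.measurableSet
    (fun z hz => ((hc z hz).hasFDerivAt.restrictScalars ℝ).hasFDerivWithinAt) T.injOn]
  refine setIntegral_congr_fun T.open_source.measurableSet fun z hz => ?_
  -- The real determinant of multiplication by `c z` is its field norm over `ℝ`.
  have hdet : (ContinuousLinearMap.restrictScalars ℝ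
      (ContinuousLinearMap.toSpanSingleton ℂ (c z))).det = ‖c z‖ ^ 2 := by
    rw [← Complex.normSq_eq_norm_sq, ← Algebra.norm_complex_apply, Algebra.norm_apply,
      ContinuousLinearMap.det]
    congr 1
    ext
    simp [mul_comm]
  have hz' := hz
  rw [hTs] at hz'
  have hback : (chartAt ℂ k).symm (T z) = (chartAt ℂ i).symm z := (chartAt ℂ k).left_inv hz'.2
  simp only [hdet, hd z hz, hback, smul_eq_mul, abs_of_nonneg (sq_nonneg ‖c z‖)]
  ring

variable [T2Space M] [CompactSpace M]

variable (M) in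
/-- On a compact surface only finitely many functions of the partition of unity do not vanish. -/
lemma _root_.exists_finset_chartPartition : ∃ s : Finset M,
    (∀ i ∉ s, ∀ x, chartPartition M i x = 0) ∧ ∀ x, ∑ i ∈ s, chartPartition M i x = 1 := by
  have hfin := (chartPartition M).locallyFinite.finite_nonempty_of_compact
  refine ⟨hfin.toFinset, ?_, ?_⟩
  · intro i hi x
    by_contra h
    exact hi (by simpa [Function.ne_iff] using ⟨x, h⟩)
  · intro x
    rw [← (chartPartition M).sum_eq_one (mem_univ x)]
    refine (finsum_eq_sum_of_support_subset _ fun i hi => ?_).symm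
    simpa [Function.ne_iff] using ⟨x, hi⟩

lemma _root_.tsupport_chartPartition (i : M) :
    tsupport (chartPartition M i) ⊆ (chartAt ℂ i).source :=
  (SmoothPartitionOfUnity.exists_isSubordinate_chartAt_source 𝓘(ℝ, ℂ) M).choose_spec i

lemma _root_.chartPartition_eq_zero {i x : M} (hx : x ∉ (chartAt ℂ i).source) :
    chartPartition M i x = 0 :=
  image_eq_zero_of_notMem_tsupport fun h => hx (tsupport_chartPartition i h)

/-- One finite index set serves all integrands, which allows differentiating the sum in a parameter.
-/
lemma integral_eq_sum {s : Finset M} (hs : ∀ i ∉ s, ∀ x, chartPartition M i x = 0) (u : M → ℝ) :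
    g.integral u = ∑ i ∈ s, ∫ z in (chartAt ℂ i).target,
      chartPartition M i ((chartAt ℂ i).symm z) *
        (u ((chartAt ℂ i).symm z) * g.chartDensity (chartAt ℂ i) z) := by
  simp only [integral, mul_assoc]
  refine finsum_eq_sum_of_support_subset _ fun i hi => ?_
  by_contra h
  exact hi (by simp [hs i h])

lemma continuousOn_chartPartition (i k : M) :
    ContinuousOn (fun z => chartPartition M i ((chartAt ℂ k).symm z)) (chartAt ℂ k).target :=
  (chartPartition M i).contMDiff.continuous.comp_continuousOn (chartAt ℂ k).continuousOn_symm

lemma integrableOn_chartPartition_mul (i : M) {f : ℂ → ℝ}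
    (hf : ContinuousOn f (chartAt ℂ i).target) :
    IntegrableOn (fun z => chartPartition M i ((chartAt ℂ i).symm z) * f z)
      (chartAt ℂ i).target := by
  obtain ⟨h1, h2, h3⟩ := isCompact_image_chart (isClosed_tsupport (chartPartition M i)).isCompact
    (tsupport_chartPartition i)
  refine integrableOn_of_continuousOn_of_compact (chartAt ℂ i).open_target h1 h2
    ((continuousOn_chartPartition i i).mul hf) fun z hz hz' => ?_
  rw [image_eq_zero_of_notMem_tsupport (h3 z hz hz'), zero_mul]

lemma integral_finset_sum {ι : Type*} (t : Finset ι) (u : ι → M → ℝ)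
    (hu : ∀ k ∈ t, ∀ i : M, ContinuousOn
      (fun z => u k ((chartAt ℂ i).symm z) * g.chartDensity (chartAt ℂ i) z)
      (chartAt ℂ i).target) :
    g.integral (fun x => ∑ k ∈ t, u k x) = ∑ k ∈ t, g.integral (u k) := by
  obtain ⟨s, hs, -⟩ := exists_finset_chartPartition M
  simp only [g.integral_eq_sum hs]
  rw [Finset.sum_comm]
  refine Finset.sum_congr rfl fun i _ => ?_
  rw [← integral_finsetSum _ fun k hk => integrableOn_chartPartition_mul i (hu k hk i)]
  simp only [Finset.sum_mul, Finset.mul_sum]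

/-- The integral of a function with compact support in a chart can be computed in that chart. -/
lemma integral_eq_chart (k : M) {u : M → ℝ} {K : Set M} (hK : IsCompact K)
    (hKk : K ⊆ (chartAt ℂ k).source) (h0 : ∀ x ∉ K, u x = 0)
    (hu : ContinuousOn (fun z => u ((chartAt ℂ k).symm z) * g.chartDensity (chartAt ℂ k) z)
      (chartAt ℂ k).target) :
    g.integral u =
      ∫ z in (chartAt ℂ k).target, u ((chartAt ℂ k).symm z) * g.chartDensity (chartAt ℂ k) z := by
  obtain ⟨s, hs, hsum⟩ := exists_finset_chartPartition M
  obtain ⟨h1, h2, h3⟩ := isCompact_image_chart hK hKk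
  rw [g.integral_eq_sum hs]
  have hi : ∀ i ∈ s, ∫ z in (chartAt ℂ i).target,
      chartPartition M i ((chartAt ℂ i).symm z) *
        (u ((chartAt ℂ i).symm z) * g.chartDensity (chartAt ℂ i) z) =
      ∫ z in (chartAt ℂ k).target, chartPartition M i ((chartAt ℂ k).symm z) *
        (u ((chartAt ℂ k).symm z) * g.chartDensity (chartAt ℂ k) z) := by
    intro i _
    simp only [← mul_assoc]
    -- Each piece is supported in both charts and can be moved to chart `k`, where the weights add
    -- up to one.
    refine g.integral_chart_eq i k (u := fun x => chartPartition M i x * u x) fun x hx => ⟨?_, ?_⟩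
    · by_contra h
      exact left_ne_zero_of_mul hx (chartPartition_eq_zero h)
    · by_contra h
      exact right_ne_zero_of_mul hx (h0 x fun h' => h (hKk h'))
  rw [Finset.sum_congr rfl hi, ← integral_finsetSum]
  · simp only [← Finset.sum_mul, hsum, one_mul]
  · intro i _
    refine integrableOn_of_continuousOn_of_compact (chartAt ℂ k).open_target h1 h2
      ((continuousOn_chartPartition i k).mul hu) fun z hz hz' => ?_
    rw [h0 _ (h3 z hz hz'), zero_mul, mul_zero]

end ConformalMetric

end Integration

/-! ## The Dirichlet integral on a plane domain -/

section PlaneDirichlet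

open Set MeasureTheory

variable {V : Type*} [NormedAddCommGroup V] [InnerProductSpace ℝ V] {U K : Set ℂ}

lemma integral_fderiv_eq_zero {φ : ℂ → ℝ} (hφ : ContDiff ℝ 1 φ) (hc : HasCompactSupport φ) (v : ℂ) :
    ∫ z, fderiv ℝ φ z v = 0 := by
  have h1 : Continuous fun z => fderiv ℝ φ z v :=
    (hφ.continuous_fderiv (by simp)).clm_apply continuous_const
  have h2 : HasCompactSupport fun z => fderiv ℝ φ z v := hc.fderiv_apply (𝕜 := ℝ) v
  have := integral_mul_fderiv_eq_neg_fderiv_mul_of_integrable (μ := volume)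
    (f := fun _ : ℂ => (1 : ℝ))
    (g := φ) (v := v) (by simp) (by simpa using h1.integrable_of_hasCompactSupport h2)
    (by simpa using hφ.continuous.integrable_of_hasCompactSupport hc)
    (fun _ _ => differentiableAt_const _) fun z _ => hφ.differentiable (by simp) z
  simpa using this

/-- Integration by parts for maps one of which has compact support. -/
lemma setIntegral_inner_fderiv_add (hU : IsOpen U) (hK : IsCompact K) (hKU : K ⊆ U) {h b : ℂ → V}
    (hh : ContDiffOn ℝ 1 h U) (hb : ContDiffOn ℝ 1 b U) (h0 : ∀ z ∈ U, z ∉ K → b z = 0) (v : ℂ) :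
    ∫ z in U, (inner ℝ (fderiv ℝ h z v) (b z) + inner ℝ (h z) (fderiv ℝ b z v)) = 0 := by
  classical
  -- Extension by zero is `C¹` on the whole plane because the product already vanishes off the
  -- compact set `K` inside `U`.
  set φ : ℂ → ℝ := U.indicator fun z => inner ℝ (h z) (b z) with hφ
  have hout : ∀ z ∉ K, φ z = 0 := by
    intro z hz
    by_cases hzU : z ∈ U
    · rw [hφ, indicator_of_mem hzU, h0 z hzU hz, inner_zero_right]
    · rw [hφ, indicator_of_notMem hzU]
  have hloc : ∀ z ∈ U, φ =ᶠ[𝓝 z] fun z => inner ℝ (h z) (b z) := fun z hz => by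
    filter_upwards [hU.mem_nhds hz] with w hw
    exact indicator_of_mem hw _
  have hC : ContDiff ℝ 1 φ := by
    rw [contDiff_iff_contDiffAt]
    intro z
    by_cases hz : z ∈ U
    · exact (((hh.contDiffAt (hU.mem_nhds hz)).inner ℝ
        (hb.contDiffAt (hU.mem_nhds hz)))).congr_of_eventuallyEq (hloc z hz)
    · refine (contDiffAt_const (c := (0 : ℝ))).congr_of_eventuallyEq ?_
      filter_upwards [hK.isClosed.isOpen_compl.mem_nhds fun h => hz (hKU h)] with w hw
      exact hout w hw
  have hsupp : HasCompactSupport φ := HasCompactSupport.intro hK hout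
  have hd : ∀ z ∈ U, fderiv ℝ φ z v =
      inner ℝ (fderiv ℝ h z v) (b z) + inner ℝ (h z) (fderiv ℝ b z v) := by
    intro z hz
    rw [(hloc z hz).fderiv_eq, fderiv_inner_apply ℝ
      ((hh.contDiffAt (hU.mem_nhds hz)).differentiableAt (by simp))
      ((hb.contDiffAt (hU.mem_nhds hz)).differentiableAt (by simp)), add_comm]
  rw [← setIntegral_congr_fun hU.measurableSet hd, ← integral_fderiv_eq_zero hC hsupp v]
  refine setIntegral_eq_integral_of_forall_compl_eq_zero fun z hz => ?_
  have : φ =ᶠ[𝓝 z] fun _ => 0 := by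
    filter_upwards [hK.isClosed.isOpen_compl.mem_nhds fun h => hz (hKU h)] with w hw
    exact hout w hw
  rw [this.fderiv_eq]
  simp

/-- The Laplacian of a map on the plane. -/
def planeLaplacian {W : Type*} [NormedAddCommGroup W] [NormedSpace ℝ W] (p : ℂ → W) (z : ℂ) : W :=
  fderiv ℝ (fun w => fderiv ℝ p w 1) z 1 + fderiv ℝ (fun w => fderiv ℝ p w Complex.I) z Complex.I

lemma ContDiffOn.fderiv_apply_const {E W : Type*} [NormedAddCommGroup E] [NormedSpace ℝ E]
    [NormedAddCommGroup W] [NormedSpace ℝ W] {U : Set E} (hU : IsOpen U) {p : E → W}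
    (hp : ContDiffOn ℝ ∞ p U) (v : E) : ContDiffOn ℝ ∞ (fun z => fderiv ℝ p z v) U :=
  (hp.fderiv_of_isOpen hU (by simp)).clm_apply contDiffOn_const

lemma continuousOn_planeGradInner (hU : IsOpen U) {p a : ℂ → V} (hp : ContDiffOn ℝ ∞ p U)
    (ha : ContDiffOn ℝ ∞ a U) : ContinuousOn (planeGradInner p a) U :=
  ((hp.fderiv_apply_const hU 1).continuousOn.inner (ha.fderiv_apply_const hU 1).continuousOn).add
    ((hp.fderiv_apply_const hU Complex.I).continuousOn.inner
      (ha.fderiv_apply_const hU Complex.I).continuousOn)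

/-- The first variation of the Dirichlet integral in a compactly supported direction which is
orthogonal to the Laplacian. -/
lemma setIntegral_planeGradInner_eq_zero (hU : IsOpen U) (hK : IsCompact K) (hKU : K ⊆ U)
    {p a : ℂ → V} (hp : ContDiffOn ℝ ∞ p U) (ha : ContDiffOn ℝ ∞ a U)
    (h0 : ∀ z ∈ U, z ∉ K → a z = 0) (hL : ∀ z ∈ U, inner ℝ (planeLaplacian p z) (a z) = 0) :
    ∫ z in U, planeGradInner p a z = 0 := by
  have hdir : ∀ v : ℂ, IntegrableOn (fun z => inner ℝ (fderiv ℝ (fun w => fderiv ℝ p w v) z v) (a z) +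
      inner ℝ (fderiv ℝ p z v) (fderiv ℝ a z v)) U := by
    intro v
    have c1 := (hp.fderiv_apply_const hU v)
    refine integrableOn_of_continuousOn_of_compact hU hK hKU
      (((c1.fderiv_apply_const hU v).continuousOn.inner ha.continuousOn).add
        (c1.continuousOn.inner (ha.fderiv_apply_const hU v).continuousOn)) fun z hz hzK => ?_
    have : a =ᶠ[𝓝 z] fun _ => 0 := by
      filter_upwards [(hU.sdiff hK.isClosed).mem_nhds ⟨hz, hzK⟩] with w hw
      exact h0 w hw.1 hw.2
    rw [this.fderiv_eq, h0 z hz hzK]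
    simp
  -- Integration by parts for the pair `(∂_v p, a)`; summing over `v = 1, I` produces the Laplacian.
  have hz := fun v : ℂ => setIntegral_inner_fderiv_add hU hK hKU
    ((hp.fderiv_apply_const hU v).of_le (by simp)) (ha.of_le (by simp)) h0 v
  have hsum := integral_add (hdir 1) (hdir Complex.I)
  rw [hz 1, hz Complex.I, add_zero] at hsum
  rw [← hsum]
  refine setIntegral_congr_fun hU.measurableSet fun z hz => ?_
  have := hL z hz
  rw [planeLaplacian, inner_add_left] at this
  simp only [planeGradInner]
  linarith

/-- Differentiation of an integral with a compactly supported weight. -/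
lemma hasDerivAt_setIntegral_mul (hU : IsOpen U) (hK : IsCompact K) (hKU : K ⊆ U) {χ : ℂ → ℝ}
    (hχ : ContinuousOn χ U) (hχ0 : ∀ z ∈ U, z ∉ K → χ z = 0) {ε : ℝ} (hε : 0 < ε) {f : ℝ × ℂ → ℝ}
    (hf : ContDiffOn ℝ 1 f (Ioo (-ε) ε ×ˢ U)) :
    HasDerivAt (fun t => ∫ z in U, χ z * f (t, z))
      (∫ z in U, χ z * fderiv ℝ f (0, z) (1, 0)) 0 := by
  have hΩ : IsOpen (Ioo (-ε) ε ×ˢ U) := isOpen_Ioo.prod hU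
  have hf' : ContinuousOn (fun q => fderiv ℝ f q (1, 0)) (Ioo (-ε) ε ×ˢ U) :=
    (hf.continuousOn_fderiv_of_isOpen hΩ le_rfl).clm_apply continuousOn_const
  have hslice : ∀ t ∈ Ioo (-ε) ε, ∀ {k : ℝ × ℂ → ℝ}, ContinuousOn k (Ioo (-ε) ε ×ˢ U) →
      ContinuousOn (fun z => χ z * k (t, z)) U := fun t ht k hk =>
    hχ.mul (hk.comp (by fun_prop) fun z hz => ⟨ht, hz⟩)
  have h0 : (0 : ℝ) ∈ Ioo (-ε) ε := by simpa using hε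
  have hsub : Icc (-(ε / 2)) (ε / 2) ⊆ Ioo (-ε) ε := fun t ht =>
    ⟨by linarith [ht.1], by linarith [ht.2]⟩
  -- Halving the interval gives a compact set of parameters, on which the derivative has a constant
  -- bound; off `K` the weight is zero.
  obtain ⟨C, hC⟩ := ((isCompact_Icc (a := -(ε / 2)) (b := ε / 2)).prod hK).exists_bound_of_continuousOn
    (f := fun q : ℝ × ℂ => χ q.2 * fderiv ℝ f q (1, 0))
    ((hχ.comp continuousOn_snd fun q hq => hKU hq.2).mul
      (hf'.mono (prod_mono hsub hKU)))
  have hs : Icc (-(ε / 2)) (ε / 2) ∈ 𝓝 (0 : ℝ) := Icc_mem_nhds (by linarith) (by linarith)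
  refine (hasDerivAt_integral_of_dominated_loc_of_deriv_le (s := Icc (-(ε / 2)) (ε / 2))
    (F' := fun t z => χ z * fderiv ℝ f (t, z) (1, 0)) (bound := K.indicator fun _ => C)
    hs ?_ ?_ ?_ ?_ ?_ ?_).2
  · filter_upwards [hs] with t ht
    exact (hslice t (hsub ht) hf.continuousOn).aestronglyMeasurable hU.measurableSet
  · exact integrableOn_of_continuousOn_of_compact hU hK hKU (hslice 0 h0 hf.continuousOn)
      fun z hz hzK => by rw [hχ0 z hz hzK, zero_mul]
  · exact (hslice 0 h0 hf').aestronglyMeasurable hU.measurableSet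
  · refine (ae_restrict_iff' hU.measurableSet).2 (Filter.Eventually.of_forall fun z hz t ht => ?_)
    by_cases hzK : z ∈ K
    · rw [indicator_of_mem hzK]
      exact hC (t, z) ⟨ht, hzK⟩
    · rw [indicator_of_notMem hzK, hχ0 z hz hzK, zero_mul, norm_zero]
  · refine (integrable_indicator_iff hK.measurableSet).2 ?_ |>.integrableOn
    exact integrableOn_const hK.measure_lt_top.ne
  · refine (ae_restrict_iff' hU.measurableSet).2 (Filter.Eventually.of_forall fun z hz t ht => ?_)
    have hd : HasFDerivAt f (fderiv ℝ f (t, z)) (t, z) :=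
      ((hf.contDiffAt (hΩ.mem_nhds ⟨hsub ht, hz⟩)).differentiableAt (by simp)).hasFDerivAt
    have hl : HasDerivAt (fun t : ℝ => (t, z)) (1, 0) t :=
      (hasDerivAt_id t).prodMk (hasDerivAt_const t z)
    exact (hd.comp_hasDerivAt t hl).const_mul (χ z)

/-- The derivative of the Dirichlet integral, weighted with a cutoff function. -/
lemma hasDerivAt_setIntegral_planeGradInner (hU : IsOpen U) (hK : IsCompact K) (hKU : K ⊆ U)
    {χ : ℂ → ℝ} (hχ : ContinuousOn χ U) (hχ0 : ∀ z ∈ U, z ∉ K → χ z = 0) {ε : ℝ} (hε : 0 < ε)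
    {q : ℝ × ℂ → V} (hq : ContDiffOn ℝ ∞ q (Ioo (-ε) ε ×ˢ U)) :
    HasDerivAt
      (fun t => ∫ z in U, χ z * planeGradInner (fun w => q (t, w)) (fun w => q (t, w)) z)
      (∫ z in U, χ z * (2 * planeGradInner (fun w => q (0, w))
        (fun w => deriv (fun t => q (t, w)) 0) z)) 0 := by
  have hΩ : IsOpen (Ioo (-ε) ε ×ˢ U) := isOpen_Ioo.prod hU
  have h0 : (0 : ℝ) ∈ Ioo (-ε) ε := by simpa using hε
  set D : ℝ × ℂ → ℝ × ℂ → V := fun v p => fderiv ℝ q p v with hD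
  have hDc : ∀ v, ContDiffOn ℝ ∞ (D v) (Ioo (-ε) ε ×ˢ U) := fun v =>
    hq.fderiv_apply_const hΩ v
  have hqd : ∀ t ∈ Ioo (-ε) ε, ∀ z ∈ U, HasFDerivAt q (fderiv ℝ q (t, z)) (t, z) :=
    fun t ht z hz =>
      ((hq.contDiffAt (hΩ.mem_nhds ⟨ht, hz⟩)).differentiableAt (by simp)).hasFDerivAt
  have hz' : ∀ {k : ℝ × ℂ → V} {L : ℝ × ℂ →L[ℝ] V} {t : ℝ} {z : ℂ}, HasFDerivAt k L (t, z) →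
      ∀ v, fderiv ℝ (fun w => k (t, w)) z v = L (0, v) := by
    intro k L t z hk v
    have hl : HasFDerivAt (fun w : ℂ => (t, w)) (ContinuousLinearMap.inr ℝ ℝ ℂ) z :=
      hasFDerivAt_prodMk_right t z
    have := (hk.comp z hl).fderiv
    exact congrArg (fun L : ℂ →L[ℝ] V => L v) this
  set f : ℝ × ℂ → ℝ := fun p => inner ℝ (D (0, 1) p) (D (0, 1) p) +
    inner ℝ (D (0, Complex.I) p) (D (0, Complex.I) p) with hf
  have hfc : ContDiffOn ℝ ∞ f (Ioo (-ε) ε ×ˢ U) :=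
    ((hDc _).inner ℝ (hDc _)).add ((hDc _).inner ℝ (hDc _))
  have hfeq : ∀ t ∈ Ioo (-ε) ε, ∀ z ∈ U,
      planeGradInner (fun w => q (t, w)) (fun w => q (t, w)) z = f (t, z) := by
    intro t ht z hz
    simp only [planeGradInner, hz' (hqd t ht z hz), hf, hD]
  have key := hasDerivAt_setIntegral_mul hU hK hKU hχ hχ0 hε (hfc.of_le (by simp))
  have hval : ∀ z ∈ U, fderiv ℝ f (0, z) (1, 0) = 2 * planeGradInner (fun w => q (0, w))
        (fun w => deriv (fun t => q (t, w)) 0) z := by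
    intro z hz
    have hmem : Ioo (-ε) ε ×ˢ U ∈ 𝓝 ((0 : ℝ), z) := hΩ.mem_nhds ⟨h0, hz⟩
    have hDd : ∀ v, DifferentiableAt ℝ (D v) (0, z) := fun v =>
      ((hDc v).contDiffAt hmem).differentiableAt (by simp)
    -- Symmetry of second derivatives turns the `t`-derivative of `dq` into the differential of the
    -- variation field.
    have hsymm : ∀ v w, fderiv ℝ (D v) (0, z) w = fderiv ℝ (D w) (0, z) v := by
      intro v w
      have hd : DifferentiableAt ℝ (fderiv ℝ q) (0, z) :=
        ((hq.fderiv_of_isOpen hΩ (m := ∞) (by simp)).contDiffAt hmem).differentiableAt (by simp)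
      have e : ∀ v w, fderiv ℝ (D v) (0, z) w = fderiv ℝ (fderiv ℝ q) (0, z) w v := by
        intro v w
        rw [hD, fderiv_clm_apply hd (differentiableAt_const v)]
        simp
      rw [e, e]
      exact ((hq.contDiffAt hmem).isSymmSndFDerivAt
        (by rw [minSmoothness_of_isRCLikeNormedField]; exact WithTop.coe_le_coe.2 (le_top : (2 : ℕ∞) ≤ ⊤))).eq w v
    have ha : (fun w => deriv (fun t => q (t, w)) 0) =ᶠ[𝓝 z] fun w => D (1, 0) (0, w) := by
      filter_upwards [hU.mem_nhds hz] with w hw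
      have hl : HasDerivAt (fun t : ℝ => (t, w)) (1, 0) 0 :=
        (hasDerivAt_id _).prodMk (hasDerivAt_const _ w)
      exact ((hqd 0 h0 w hw).comp_hasDerivAt 0 hl).deriv
    simp only [planeGradInner, ha.fderiv_eq, hz' (hqd 0 h0 z hz), hz' (hDd _).hasFDerivAt]
    rw [hf, fderiv_fun_add ((hDd _).inner ℝ (hDd _)) ((hDd _).inner ℝ (hDd _)),
      add_apply, fderiv_inner_apply ℝ (hDd _) (hDd _),
      fderiv_inner_apply ℝ (hDd _) (hDd _), hsymm, hsymm (0, Complex.I)]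
    simp only [real_inner_comm (D (0, 1) (0, z)), real_inner_comm (D (0, Complex.I) (0, z))]
    simp only [hD]
    ring
  rw [setIntegral_congr_fun hU.measurableSet
    (fun z hz => show _ = χ z * fderiv ℝ f (0, z) (1, 0) by rw [hval z hz])]
  refine key.congr_of_eventuallyEq ?_
  filter_upwards [isOpen_Ioo.mem_nhds h0] with t ht
  exact setIntegral_congr_fun hU.measurableSet fun z hz => by simp only [hfeq t ht z hz]

end PlaneDirichlet

/-! ## The first variation of the energy -/

section FirstVariation

open Set MeasureTheory

variable {M : Type*} [TopologicalSpace M] [ChartedSpace ℂ M] [IsManifold 𝓘(ℂ) ω M]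
  {V : Type*} [NormedAddCommGroup V] [InnerProductSpace ℝ V]

lemma contMDiffAt_prodMk_chartAt_symm (i : M) {t : ℝ} {z : ℂ} (hz : z ∈ (chartAt ℂ i).target) :
    ContMDiffAt 𝓘(ℝ, ℝ × ℂ) (𝓘(ℝ, ℝ).prod 𝓘(ℝ, ℂ)) ∞
      (fun p : ℝ × ℂ => (p.1, (chartAt ℂ i).symm p.2)) (t, z) := by
  refine contDiff_fst.contMDiff.contMDiffAt.prodMk ?_
  exact ContMDiffAt.comp (I' := 𝓘(ℝ, ℂ)) (t, z) (contMDiffAt_chartAt_symm i hz)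
    contDiff_snd.contMDiff.contMDiffAt

lemma contDiffOn_comp_chartAt_symm (i : M) {P : M → V} (hP : ContMDiff 𝓘(ℝ, ℂ) 𝓘(ℝ, V) ∞ P) :
    ContDiffOn ℝ ∞ (fun z => P ((chartAt ℂ i).symm z)) (chartAt ℂ i).target := fun _ hz =>
  ((hP.contMDiffAt.comp _ (contMDiffAt_chartAt_symm i hz)).contDiffAt).contDiffWithinAt

lemma contMDiff_of_contDiffOn_charts {P : M → V}
    (hP : ∀ i : M, ContDiffOn ℝ ∞ (fun z => P ((chartAt ℂ i).symm z)) (chartAt ℂ i).target) :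
    ContMDiff 𝓘(ℝ, ℂ) 𝓘(ℝ, V) ∞ P := by
  intro x
  have h1 : ContMDiffAt 𝓘(ℝ, ℂ) 𝓘(ℝ, ℂ) ∞ (chartAt ℂ x) x :=
    ((contMDiffOn_chart (I := 𝓘(ℝ, ℂ)) (x := x) (n := ω)).contMDiffAt
      ((chartAt ℂ x).open_source.mem_nhds (mem_chart_source ℂ x))).of_le (by simp)
  have h2 := ((hP x).contDiffAt ((chartAt ℂ x).open_target.mem_nhds
    (mem_chart_target ℂ x))).contMDiffAt
  refine (h2.comp x h1).congr_of_eventuallyEq ?_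
  filter_upwards [(chartAt ℂ x).open_source.mem_nhds (mem_chart_source ℂ x)] with y hy
  simp [(chartAt ℂ x).left_inv hy]

namespace ConformalMetric

variable (g : ConformalMetric M)

lemma gradInner_finset_sum {ι : Type*} (s : Finset ι) {P : M → V} {A : ι → M → V} {x : M}
    (hA : ∀ k ∈ s, MDifferentiableAt 𝓘(ℝ, ℂ) 𝓘(ℝ, V) (A k) x) :
    g.gradInner P (fun y => ∑ k ∈ s, A k y) x = ∑ k ∈ s, g.gradInner P (A k) x := by
  have h : surfaceDeriv (fun y => ∑ k ∈ s, A k y) x = ∑ k ∈ s, surfaceDeriv (A k) x := by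
    -- The type of a manifold derivative depends on the map, so map and derivative are named
    -- separately and tied by equations before the induction.
    suffices ∀ (F : M → V) (L : ℂ →L[ℝ] V), F = (fun y => ∑ k ∈ s, A k y) →
        L = ∑ k ∈ s, surfaceDeriv (A k) x → HasMFDerivAt 𝓘(ℝ, ℂ) 𝓘(ℝ, V) F x L from
      (this _ _ rfl rfl).mfderiv
    classical
    induction s using Finset.induction_on with
    | empty =>
      rintro _ _ rfl rfl
      exact hasMFDerivAt_const (0 : V) x
    | insert k s hk ih =>
      intro F L hF hL
      have h1 : HasMFDerivAt 𝓘(ℝ, ℂ) 𝓘(ℝ, V) (A k) x (surfaceDeriv (A k) x) :=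
        (hA k (Finset.mem_insert_self k s)).hasMFDerivAt
      simp only [Finset.sum_insert hk] at hF hL
      rw [hF, hL]
      exact h1.add (ih (fun l hl => hA l (Finset.mem_insert_of_mem hl)) _ _ rfl rfl)
  simp only [gradInner, h, sum_apply, inner_sum, ← Finset.sum_add_distrib,
    Finset.sum_div]

lemma continuousOn_gradInner_mul (i : M) {P A : M → V} (hP : ContMDiff 𝓘(ℝ, ℂ) 𝓘(ℝ, V) ∞ P)
    (hA : ContMDiff 𝓘(ℝ, ℂ) 𝓘(ℝ, V) ∞ A) :
    ContinuousOn (fun z => g.gradInner P A ((chartAt ℂ i).symm z) *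
      g.chartDensity (chartAt ℂ i) z) (chartAt ℂ i).target :=
  (continuousOn_planeGradInner (chartAt ℂ i).open_target (contDiffOn_comp_chartAt_symm i hP)
    (contDiffOn_comp_chartAt_symm i hA)).congr fun _ hz =>
    g.gradInner_mul_chartDensity i hz (hP.mdifferentiable (by simp) _)
      (hA.mdifferentiable (by simp) _)

variable [T2Space M] [CompactSpace M]

/-- The integral of `⟨dP, dA⟩` vanishes if `A` is orthogonal to the Laplacian of `P`. -/
lemma integral_gradInner_eq_zero {P A : M → V} (hP : ContMDiff 𝓘(ℝ, ℂ) 𝓘(ℝ, V) ∞ P)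
    (hA : ContMDiff 𝓘(ℝ, ℂ) 𝓘(ℝ, V) ∞ A)
    (hL : ∀ i : M, ∀ z ∈ (chartAt ℂ i).target,
      inner ℝ (planeLaplacian (fun w => P ((chartAt ℂ i).symm w)) z)
        (A ((chartAt ℂ i).symm z)) = 0) :
    g.integral (g.gradInner P A) = 0 := by
  obtain ⟨s, -, hs⟩ := exists_finset_chartPartition M
  have hB : ∀ k, ContMDiff 𝓘(ℝ, ℂ) 𝓘(ℝ, V) ∞ fun x => chartPartition M k x • A x := fun k =>
    (chartPartition M k).contMDiff.smul hA
  -- The direction `A` is cut up, not the integrand. Each piece is then a compactly supported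
  -- variation, still orthogonal to the Laplacian, and no derivative of the cutoff is left over.
  have hsum : g.gradInner P A =
      fun x => ∑ k ∈ s, g.gradInner P (fun x => chartPartition M k x • A x) x := by
    ext x
    rw [← g.gradInner_finset_sum s fun k _ => (hB k).mdifferentiable (by simp) x]
    simp only [← Finset.sum_smul, hs, one_smul]
  rw [hsum, g.integral_finset_sum s _ fun k _ i => g.continuousOn_gradInner_mul i hP (hB k)]
  refine Finset.sum_eq_zero fun k _ => ?_
  have hK := (isClosed_tsupport (chartPartition M k)).isCompact
  obtain ⟨h1, h2, h3⟩ := isCompact_image_chart hK (tsupport_chartPartition k)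
  rw [g.integral_eq_chart k hK (tsupport_chartPartition k) _
    (g.continuousOn_gradInner_mul k hP (hB k))]
  · rw [setIntegral_congr_fun (chartAt ℂ k).open_target.measurableSet fun z hz =>
      g.gradInner_mul_chartDensity k hz (hP.mdifferentiable (by simp) _)
        ((hB k).mdifferentiable (by simp) _)]
    refine setIntegral_planeGradInner_eq_zero (chartAt ℂ k).open_target h1 h2
      (contDiffOn_comp_chartAt_symm k hP) (contDiffOn_comp_chartAt_symm k (hB k)) ?_ ?_
    · intro z hz hz'
      rw [image_eq_zero_of_notMem_tsupport (h3 z hz hz'), zero_smul]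
    · intro z hz
      rw [real_inner_smul_right, hL k z hz, mul_zero]
  · intro x hx
    have h0 : (fun x => chartPartition M k x • A x) =ᶠ[𝓝 x] fun _ => 0 := by
      filter_upwards [(isClosed_tsupport (chartPartition M k)).isOpen_compl.mem_nhds hx] with y hy
      rw [image_eq_zero_of_notMem_tsupport hy, zero_smul]
    have h4 : surfaceDeriv (fun x => chartPartition M k x • A x) x = 0 := by
      have : HasMFDerivAt 𝓘(ℝ, ℂ) 𝓘(ℝ, V) (fun x => chartPartition M k x • A x) x
          (0 : ℂ →L[ℝ] V) := (hasMFDerivAt_const (0 : V) x).congr_of_eventuallyEq h0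
      exact this.mfderiv
    simp [gradInner, h4]

/-- A map into a Euclidean space is a critical point of the Dirichlet integral in the direction of
a variation which is orthogonal to its Laplacian. -/
theorem hasDerivAt_integral_gradInner {ε : ℝ} (hε : 0 < ε) {Q : ℝ → M → V}
    (hQ : ∀ t x, |t| < ε → ContMDiffAt (𝓘(ℝ, ℝ).prod 𝓘(ℝ, ℂ)) 𝓘(ℝ, V) ∞
      (fun q : ℝ × M => Q q.1 q.2) (t, x))
    (hL : ∀ i : M, ∀ z ∈ (chartAt ℂ i).target,
      inner ℝ (planeLaplacian (fun w => Q 0 ((chartAt ℂ i).symm w)) z)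
        (deriv (fun t => Q t ((chartAt ℂ i).symm z)) 0) = 0) :
    HasDerivAt (fun t => g.integral (g.gradInner (Q t) (Q t))) 0 0 := by
  have hq : ∀ i : M, ContDiffOn ℝ ∞ (fun p : ℝ × ℂ => Q p.1 ((chartAt ℂ i).symm p.2))
      (Ioo (-ε) ε ×ˢ (chartAt ℂ i).target) := fun i p hp =>
    (ContMDiffAt.comp (g := fun q : ℝ × M => Q q.1 q.2) p
      (hQ p.1 ((chartAt ℂ i).symm p.2) (abs_lt.2 hp.1))
      (contMDiffAt_prodMk_chartAt_symm i hp.2)).contDiffAt.contDiffWithinAt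
  have hQt : ∀ t, |t| < ε → ContMDiff 𝓘(ℝ, ℂ) 𝓘(ℝ, V) ∞ (Q t) := fun t ht x =>
    (hQ t x ht).comp x (contMDiffAt_const.prodMk contMDiffAt_id)
  have h0 : (0 : ℝ) ∈ Ioo (-ε) ε := by simpa using hε
  have h0' : |(0 : ℝ)| < ε := by simpa using hε
  set A : M → V := fun x => deriv (fun t => Q t x) 0 with hAdef
  have hA : ContMDiff 𝓘(ℝ, ℂ) 𝓘(ℝ, V) ∞ A := by
    refine contMDiff_of_contDiffOn_charts fun i => ?_
    have hΩ := (isOpen_Ioo (a := -ε) (b := ε)).prod (chartAt ℂ i).open_target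
    have h1 : ContDiffOn ℝ ∞ (fun z : ℂ => fderiv ℝ
        (fun p : ℝ × ℂ => Q p.1 ((chartAt ℂ i).symm p.2)) (0, z) (1, 0)) (chartAt ℂ i).target :=
      ((hq i).fderiv_apply_const hΩ (1, 0)).comp (f := fun z : ℂ => ((0 : ℝ), z))
        (by fun_prop) fun z hz => show ((0 : ℝ), z) ∈ _ from ⟨h0, hz⟩
    refine h1.congr fun z hz => ?_
    have hmem : ((0 : ℝ), z) ∈ Ioo (-ε) ε ×ˢ (chartAt ℂ i).target := ⟨h0, hz⟩
    have hd := (((hq i).contDiffAt (hΩ.mem_nhds hmem)).differentiableAt (by simp)).hasFDerivAt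
    have hl : HasDerivAt (fun t : ℝ => (t, z)) (1, 0) 0 :=
      (hasDerivAt_id _).prodMk (hasDerivAt_const _ z)
    exact (hd.comp_hasDerivAt 0 hl).deriv
  obtain ⟨s, hs, -⟩ := exists_finset_chartPartition M
  have hsum : HasDerivAt (fun t => ∑ i ∈ s, ∫ z in (chartAt ℂ i).target,
      chartPartition M i ((chartAt ℂ i).symm z) *
        planeGradInner (fun w => Q t ((chartAt ℂ i).symm w))
          (fun w => Q t ((chartAt ℂ i).symm w)) z)
      (∑ i ∈ s, ∫ z in (chartAt ℂ i).target, chartPartition M i ((chartAt ℂ i).symm z) *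
        (2 * planeGradInner (fun w => Q 0 ((chartAt ℂ i).symm w))
          (fun w => A ((chartAt ℂ i).symm w)) z)) 0 := by
    refine HasDerivAt.fun_sum fun i _ => ?_
    obtain ⟨h1, h2, h3⟩ := isCompact_image_chart
      (isClosed_tsupport (chartPartition M i)).isCompact (tsupport_chartPartition i)
    exact hasDerivAt_setIntegral_planeGradInner (chartAt ℂ i).open_target h1 h2
      (continuousOn_chartPartition i i)
      (fun z hz hz' => image_eq_zero_of_notMem_tsupport (h3 z hz hz')) hε (hq i)
  -- The weighted chart integrals reassemble to twice the global integral of `⟨dQ₀, dA⟩`.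
  have hval : ∑ i ∈ s, ∫ z in (chartAt ℂ i).target, chartPartition M i ((chartAt ℂ i).symm z) *
        (2 * planeGradInner (fun w => Q 0 ((chartAt ℂ i).symm w))
          (fun w => A ((chartAt ℂ i).symm w)) z) = 0 := by
    have hz := g.integral_gradInner_eq_zero (hQt 0 h0') hA hL
    rw [g.integral_eq_sum hs] at hz
    refine Eq.trans ?_ ((congrArg (fun r : ℝ => 2 * r) hz).trans (mul_zero 2))
    simp only [Finset.mul_sum]
    refine Finset.sum_congr rfl fun i _ => ?_
    rw [← integral_const_mul]
    refine setIntegral_congr_fun (chartAt ℂ i).open_target.measurableSet fun z hz => ?_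
    simp only [g.gradInner_mul_chartDensity i hz ((hQt 0 h0').mdifferentiable (by simp) _)
        (hA.mdifferentiable (by simp) _)]
    ring
  rw [hval] at hsum
  refine hsum.congr_of_eventuallyEq ?_
  filter_upwards [isOpen_Ioo.mem_nhds h0] with t ht
  rw [g.integral_eq_sum hs]
  refine Finset.sum_congr rfl fun i _ => ?_
  refine setIntegral_congr_fun (chartAt ℂ i).open_target.measurableSet fun z hz => ?_
  have hd := (hQt t (abs_lt.2 ht)).mdifferentiable (by simp) ((chartAt ℂ i).symm z)
  simp only [g.gradInner_mul_chartDensity i hz hd hd]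

/-! ### The energy as a Dirichlet integral and the criterion for harmonicity -/

variable {N : ℕ}

omit [T2Space M] [CompactSpace M] in
-- For a tangent vector `w` at the line of `u`, the metric `4 g_FS` gives `4|w|²/|u|²` and the
-- projection embedding gives `2|w|²/|u|²`.
lemma hilbertSchmidtSq_eq {f : M → ℙ ℂ (EuclideanSpace ℂ (Fin N))} {x : M}
    (hf : ProjSmoothAt 𝓘(ℝ, ℂ) f x) :
    g.hilbertSchmidtSq f x =
      2 * g.gradInner (fun y => lineProj (f y)) (fun y => lineProj (f y)) x := by
  have h0 : ‖(f x).rep‖ ≠ 0 := norm_ne_zero_iff.2 (f x).rep_nonzero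
  have key : ∀ ξ : TangentSpace 𝓘(ℝ, ℂ) x, projDerivNormSq f x ξ =
      2 * ‖surfaceDeriv (fun y => lineProj (f y)) x ξ‖ ^ 2 := by
    intro ξ
    obtain ⟨w, hw, ho, hP⟩ := hf.mfderiv_lineProj ξ
    have hP' : surfaceDeriv (fun y => lineProj (f y)) x ξ = _ := hP
    have hw' : projDeriv f x ξ = w := hw
    rw [projDerivNormSq, hw', hP', norm_smul, mul_pow, norm_sq_rankOne_add ho]
    simp only [norm_inv, norm_pow, norm_norm]
    field_simp
    ring
  have hJ : g.normSq x (tangentJ (tangentOne x)) = g.normSq x (tangentOne x) :=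
    g.conformal x _ _
  have e : (tangentJ (tangentOne x)) = (Complex.I : ℂ) := mul_one Complex.I
  rw [hilbertSchmidtSq, key, key, hJ, gradInner, ← add_div, e, ← mul_add,
    real_inner_self_eq_norm_sq, real_inner_self_eq_norm_sq, mul_div_assoc]
  rfl

/-- A criterion for harmonicity: the tangential part of the Laplacian vanishes. -/
theorem isHarmonic_of_laplacian {f : M → ℙ ℂ (EuclideanSpace ℂ (Fin N))}
    (hf : ∀ x, ProjSmoothAt 𝓘(ℝ, ℂ) f x)
    (hL : ∀ i : M, ∀ z ∈ (chartAt ℂ i).target, ∀ w : EuclideanSpace ℂ (Fin N),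
      inner ℂ (f ((chartAt ℂ i).symm z)).rep w = 0 →
      inner ℝ (planeLaplacian (fun w => lineProj (f ((chartAt ℂ i).symm w))) z)
        (rankOne w (f ((chartAt ℂ i).symm z)).rep +
          rankOne (f ((chartAt ℂ i).symm z)).rep w) = 0) :
    g.IsHarmonic f := by
  refine ⟨hf, fun ε Φ hε hΦ h0 => ?_⟩
  have key := g.hasDerivAt_integral_gradInner hε (Q := fun t x => lineProj (Φ t x))
    (fun t x ht => (hΦ t x ht).contMDiffAt_lineProj) fun i z hz => by
      -- At a fixed point the variation is a smooth curve in projective space, so its velocity is a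
      -- multiple of some `w v^* + v w^*` with `w ⊥ v`.
      have hs : ProjSmoothAt 𝓘(ℝ, ℝ) (fun t => Φ t ((chartAt ℂ i).symm z)) 0 := by
        obtain ⟨F, hF, hF'⟩ := hΦ 0 ((chartAt ℂ i).symm z) (by simpa using hε)
        have hl : ContMDiffAt 𝓘(ℝ, ℝ) (𝓘(ℝ, ℝ).prod 𝓘(ℝ, ℂ)) ∞
          (fun t : ℝ => (t, (chartAt ℂ i).symm z)) 0 := contMDiffAt_id.prodMk contMDiffAt_const
        exact ⟨fun t => F (t, (chartAt ℂ i).symm z), hF.comp 0 hl,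
          hl.continuousAt.eventually hF'⟩
      obtain ⟨w, -, ho, hP⟩ := hs.mfderiv_lineProj (1 : ℝ)
      rw [mfderiv_eq_fderiv] at hP
      have hd : deriv (fun t => lineProj (Φ t ((chartAt ℂ i).symm z))) 0 = _ := hP
      rw [hd, h0, real_inner_smul_right, hL i z hz w (by rw [← h0]; exact ho), mul_zero]
  -- For small `t` the energy equals the Dirichlet integral: the factor `1/2` cancels the `2` of
  -- `hilbertSchmidtSq_eq`.
  refine key.congr_of_eventuallyEq ?_
  filter_upwards [isOpen_Ioo.mem_nhds (show (0 : ℝ) ∈ Ioo (-ε) ε by simpa using hε)] with t ht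
  have hs : ∀ x, ProjSmoothAt 𝓘(ℝ, ℂ) (Φ t) x := by
    intro x
    obtain ⟨F, hF, hF'⟩ := hΦ t x (abs_lt.2 ht)
    have hl : ContMDiffAt 𝓘(ℝ, ℂ) (𝓘(ℝ, ℝ).prod 𝓘(ℝ, ℂ)) ∞
      (fun y : M => (t, y)) x := contMDiffAt_const.prodMk contMDiffAt_id
    exact ⟨fun y => F (t, y), hF.comp x hl, hl.continuousAt.eventually hF'⟩
  obtain ⟨s, hs', -⟩ := exists_finset_chartPartition M
  rw [energy, g.integral_eq_sum hs', g.integral_eq_sum hs', Finset.mul_sum]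
  refine Finset.sum_congr rfl fun i _ => ?_
  rw [← integral_const_mul]
  simp only [g.hilbertSchmidtSq_eq (hs _)]
  congr 1
  ext z
  ring

end ConformalMetric

end FirstVariation

/-! ## Wirtinger derivatives and the Laplacian of a projection -/

section Wirtinger

variable {W : Type*} [NormedAddCommGroup W] [NormedSpace ℂ W]

/-- The operator `2 ∂/∂z̄ = ∂/∂x + i ∂/∂y`. -/
def planeDbar (p : ℂ → W) (z : ℂ) : W := fderiv ℝ p z 1 + Complex.I • fderiv ℝ p z Complex.I

/-- The operator `2 ∂/∂z = ∂/∂x - i ∂/∂y`. -/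
def planeDel (p : ℂ → W) (z : ℂ) : W := fderiv ℝ p z 1 - Complex.I • fderiv ℝ p z Complex.I

lemma planeDbar_mul {f h : ℂ → ℂ} {z : ℂ} (hf : DifferentiableAt ℝ f z)
    (hh : DifferentiableAt ℝ h z) :
    planeDbar (fun w => f w * h w) z = planeDbar f z * h z + f z * planeDbar h z := by
  simp only [planeDbar, fderiv_fun_mul hf hh, add_apply, smul_apply, smul_eq_mul]
  ring

lemma planeDel_mul {f h : ℂ → ℂ} {z : ℂ} (hf : DifferentiableAt ℝ f z)
    (hh : DifferentiableAt ℝ h z) :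
    planeDel (fun w => f w * h w) z = planeDel f z * h z + f z * planeDel h z := by
  simp only [planeDel, fderiv_fun_mul hf hh, add_apply, smul_apply, smul_eq_mul]
  ring

lemma planeDel_add {f h : ℂ → W} {z : ℂ} (hf : DifferentiableAt ℝ f z)
    (hh : DifferentiableAt ℝ h z) :
    planeDel (fun w => f w + h w) z = planeDel f z + planeDel h z := by
  simp only [planeDel, fderiv_fun_add hf hh, add_apply, smul_add]
  abel

lemma Filter.EventuallyEq.planeDbar_eq {f h : ℂ → W} {z : ℂ} (hfh : f =ᶠ[𝓝 z] h) :
    planeDbar f z = planeDbar h z := by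
  simp only [planeDbar, hfh.fderiv_eq]

lemma Filter.EventuallyEq.planeDel_eq {f h : ℂ → W} {z : ℂ} (hfh : f =ᶠ[𝓝 z] h) :
    planeDel f z = planeDel h z := by
  simp only [planeDel, hfh.fderiv_eq]

lemma ContDiffAt.fderiv_apply_const {E V : Type*} [NormedAddCommGroup E] [NormedSpace ℝ E]
    [NormedAddCommGroup V] [NormedSpace ℝ V] {p : E → V} {z : E}
    (hp : ContDiffAt ℝ ∞ p z) (v : E) : ContDiffAt ℝ ∞ (fun z => fderiv ℝ p z v) z :=
  (hp.fderiv_right (m := ∞) (by simp)).clm_apply contDiffAt_const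

lemma ContDiffAt.planeDbar {p : ℂ → W} {z : ℂ} (hp : ContDiffAt ℝ ∞ p z) :
    ContDiffAt ℝ ∞ (planeDbar p) z :=
  (hp.fderiv_apply_const 1).add (contDiffAt_const.smul (hp.fderiv_apply_const Complex.I))

/-- The mixed terms of `(∂_x - i∂_y)(∂_x + i∂_y)` cancel by symmetry. No factor `4` appears, since
each operator already carries a factor `2`. -/
lemma planeLaplacian_eq {p : ℂ → W} {z : ℂ} (hp : ContDiffAt ℝ ∞ p z) :
    planeLaplacian p z = planeDel (planeDbar p) z := by
  have hd := fun v => (hp.fderiv_apply_const v).differentiableAt (by simp)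
  have e : ∀ v w, fderiv ℝ (fun y => fderiv ℝ p y v) z w = fderiv ℝ (fderiv ℝ p) z w v := by
    intro v w
    rw [fderiv_clm_apply ((hp.fderiv_right (m := ∞) (by simp)).differentiableAt (by simp))
      (differentiableAt_const v)]
    simp
  have hs : fderiv ℝ (fderiv ℝ p) z 1 Complex.I = fderiv ℝ (fderiv ℝ p) z Complex.I 1 :=
    (hp.isSymmSndFDerivAt (by rw [minSmoothness_of_isRCLikeNormedField]
                              exact WithTop.coe_le_coe.2 (le_top : (2 : ℕ∞) ≤ ⊤))).eq _ _
  have h1 : ∀ v, fderiv ℝ (planeDbar p) z v = fderiv ℝ (fderiv ℝ p) z v 1 +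
      Complex.I • fderiv ℝ (fderiv ℝ p) z v Complex.I := by
    intro v
    have h2 : HasFDerivAt (planeDbar p) _ z :=
      (hd 1).hasFDerivAt.add ((hd Complex.I).hasFDerivAt.const_smul Complex.I)
    rw [h2.fderiv]
    simp [e]
  rw [planeDel, h1, h1, planeLaplacian, e, e, hs, smul_add, smul_smul, Complex.I_mul_I]
  module

lemma planeLaplacian_clm_comp {V V' : Type*} [NormedAddCommGroup V] [NormedSpace ℝ V]
    [NormedAddCommGroup V'] [NormedSpace ℝ V'] (L : V →L[ℝ] V') {p : ℂ → V} {z : ℂ}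
    (hp : ContDiffAt ℝ ∞ p z) :
    planeLaplacian (fun w => L (p w)) z = L (planeLaplacian p z) := by
  have h1 : ∀ v, (fun w => fderiv ℝ (fun y => L (p y)) w v) =ᶠ[𝓝 z]
      fun w => L (fderiv ℝ p w v) := by
    intro v
    filter_upwards [(hp.of_le (m := 1) (by simp)).eventually (by simp)] with w hw
    exact congrArg (fun l : ℂ →L[ℝ] V' => l v)
      (L.hasFDerivAt.comp w (hw.differentiableAt (by simp)).hasFDerivAt).fderiv
  have h2 : ∀ v, fderiv ℝ (fun w => L (fderiv ℝ p w v)) z v =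
      L (fderiv ℝ (fun w => fderiv ℝ p w v) z v) := fun v =>
    congrArg (fun l : ℂ →L[ℝ] V' => l v) (L.hasFDerivAt.comp z
      ((hp.fderiv_apply_const v).differentiableAt (by simp)).hasFDerivAt).fderiv
  simp only [planeLaplacian, (h1 _).fderiv_eq, h2, map_add]

variable {N : ℕ} {F G : ℂ → EuclideanSpace ℂ (Fin N)} {z : ℂ}

lemma hasFDerivAt_inner_const_left (u : EuclideanSpace ℂ (Fin N)) (hF : DifferentiableAt ℝ F z) :
    HasFDerivAt (fun y => inner ℂ u (F y))
      (((innerSL ℂ u).restrictScalars ℝ).comp (fderiv ℝ F z)) z :=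
  ((innerSL ℂ u).restrictScalars ℝ).hasFDerivAt.comp z hF.hasFDerivAt

lemma hasFDerivAt_inner_const_right (u : EuclideanSpace ℂ (Fin N))
    (hF : DifferentiableAt ℝ F z) :
    HasFDerivAt (fun y => inner ℂ (F y) u)
      ((Complex.conjCLE : ℂ →L[ℝ] ℂ).comp
        (((innerSL ℂ u).restrictScalars ℝ).comp (fderiv ℝ F z))) z := by
  have h : (fun y => inner ℂ (F y) u) = fun y => Complex.conjCLE (inner ℂ u (F y)) := by
    ext y; simp
  rw [h]
  exact (Complex.conjCLE : ℂ →L[ℝ] ℂ).hasFDerivAt.comp z (hasFDerivAt_inner_const_left u hF)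

lemma planeDbar_inner_left (u : EuclideanSpace ℂ (Fin N)) (hF : DifferentiableAt ℝ F z) :
    planeDbar (fun y => inner ℂ u (F y)) z = inner ℂ u (planeDbar F z) := by
  simp [planeDbar, (hasFDerivAt_inner_const_left u hF).fderiv]

lemma planeDel_inner_left (u : EuclideanSpace ℂ (Fin N)) (hF : DifferentiableAt ℝ F z) :
    planeDel (fun y => inner ℂ u (F y)) z = inner ℂ u (planeDel F z) := by
  simp [planeDel, (hasFDerivAt_inner_const_left u hF).fderiv]

/-- The inner product is antilinear in its first slot, which exchanges `∂` and `∂̄`. -/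
lemma planeDbar_inner_right (u : EuclideanSpace ℂ (Fin N)) (hF : DifferentiableAt ℝ F z) :
    planeDbar (fun y => inner ℂ (F y) u) z = inner ℂ (planeDel F z) u := by
  simp [planeDbar, planeDel, (hasFDerivAt_inner_const_right u hF).fderiv, mul_comm]

lemma planeDel_inner_right (u : EuclideanSpace ℂ (Fin N)) (hF : DifferentiableAt ℝ F z) :
    planeDel (fun y => inner ℂ (F y) u) z = inner ℂ (planeDbar F z) u := by
  simp [planeDbar, planeDel, (hasFDerivAt_inner_const_right u hF).fderiv, mul_comm,
    sub_eq_add_neg]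

lemma planeDbar_inner_self (hF : DifferentiableAt ℝ F z) :
    planeDbar (fun y => inner ℂ (F y) (F y)) z =
      inner ℂ (planeDel F z) (F z) + inner ℂ (F z) (planeDbar F z) := by
  simp only [planeDbar, planeDel, fderiv_inner_apply ℂ hF hF, inner_sub_left, inner_smul_left,
    inner_add_right, inner_smul_right, smul_eq_mul, Complex.conj_I]
  ring

/-- The two summands contribute complex conjugate numbers. Writing the result as a real part of
products and quotients of inner products prepares for Wirtinger calculus. -/
lemma inner_rankOneProj_rankOne_add (u v w : EuclideanSpace ℂ (Fin N)) :
    inner ℝ (rankOne w v + rankOne v w) (rankOneProj u) =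
      2 * (inner ℂ w u * (inner ℂ u v * (inner ℂ u u)⁻¹)).re := by
  have h : (inner ℂ u u)⁻¹ = (((‖u‖ ^ 2)⁻¹ : ℝ) : ℂ) := by
    rw [inner_self_eq_norm_sq_to_K]; simp
  rw [rankOneProj, real_inner_smul_right, euclidean_real_inner_eq_re, inner_add_left,
    inner_rankOne, inner_rankOne, h, ← mul_assoc, Complex.re_mul_ofReal, Complex.add_re,
    ← inner_conj_symm v u, ← inner_conj_symm u w, ← map_mul, Complex.conj_re,
    mul_comm (inner ℂ u v)]
  ring

/-- If `2 ∂F/∂z̄ = |F|² G` with `G ⊥ F` and `∂G/∂z ∈ ℂ F`, then the tangential component of the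
Laplacian of the projection onto the line spanned by `F` vanishes. -/
theorem inner_planeLaplacian_rankOneProj (hF : ContDiffAt ℝ ∞ F z) (hG : ContDiffAt ℝ ∞ G z)
    (h0 : F z ≠ 0) (hdbar : ∀ᶠ y in 𝓝 z, planeDbar F y = (inner ℂ (F y) (F y) : ℂ) • G y)
    (horth : inner ℂ (F z) (G z) = 0) {b : ℂ} (hdel : planeDel G z = b • F z) {c : ℂ}
    {w : EuclideanSpace ℂ (Fin N)} (hw : inner ℂ (F z) w = 0) :
    inner ℝ (planeLaplacian (fun y => rankOneProj (F y)) z)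
      (rankOne w (c • F z) + rankOne (c • F z) w) = 0 := by
  set v := c • F z with hv
  set k : ℂ → ℂ := fun y => inner ℂ w (F y) with hk
  set h : ℂ → ℂ := fun y => inner ℂ (F y) v * (inner ℂ (F y) (F y))⁻¹ with hh
  have hFd : DifferentiableAt ℝ F z := hF.differentiableAt (by simp)
  have hi0 : (inner ℂ (F z) (F z) : ℂ) ≠ 0 := inner_self_ne_zero.2 h0
  have hkc : ContDiffAt ℝ ∞ k z := ((innerSL ℂ w).restrictScalars ℝ).contDiff.contDiffAt.comp z hF
  have hic : ContDiffAt ℝ ∞ (fun y => inner ℂ (F y) (F y)) z := hF.inner ℂ hF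
  have hvc : ContDiffAt ℝ ∞ (fun y => inner ℂ (F y) v) z := hF.inner ℂ contDiffAt_const
  have hhc : ContDiffAt ℝ ∞ h z := hvc.mul (hic.inv hi0)
  have hgc : ContDiffAt ℝ ∞ (fun y => inner ℂ w (G y)) z :=
    ((innerSL ℂ w).restrictScalars ℝ).contDiff.contDiffAt.comp z hG
  have hk0 : k z = 0 := inner_eq_zero_symm.1 hw
  have hFne : ∀ᶠ y in 𝓝 z, (inner ℂ (F y) (F y) : ℂ) ≠ 0 := hic.continuousAt.eventually_ne hi0
  -- Apply `∂̄` to `h ⟨F, F⟩ = ⟨F, v⟩`. At `z` one has `h = c`, `v = c F` and `⟨F, ∂̄F⟩ = 0`, so the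
  -- terms with `⟨∂F, F⟩` cancel.
  have hh0 : planeDbar h z = 0 := by
    have e1 : (fun y => h y * inner ℂ (F y) (F y)) =ᶠ[𝓝 z] fun y => inner ℂ (F y) v := by
      filter_upwards [hFne] with y hy
      rw [hh]
      field_simp
    have e2 := e1.planeDbar_eq
    rw [planeDbar_mul (hhc.differentiableAt (by simp)) (hic.differentiableAt (by simp)),
      planeDbar_inner_right v hFd, planeDbar_inner_self hFd, hdbar.self_of_nhds,
      inner_smul_right, horth, mul_zero, add_zero] at e2
    have e3 : h z = c := by
      simp only [hh, hv, inner_smul_right]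
      field_simp
    rw [e3, hv, inner_smul_right, add_eq_right] at e2
    exact (mul_eq_zero.1 e2).resolve_right hi0
  have hθ : planeLaplacian (fun y => k y * h y) z = 0 := by
    rw [planeLaplacian_eq (hkc.mul hhc)]
    -- The factor `|F|²` of `∂̄F` cancels the denominator of `h`.
    have e : planeDbar (fun y => k y * h y) =ᶠ[𝓝 z]
        fun y => inner ℂ w (G y) * inner ℂ (F y) v + k y * planeDbar h y := by
      filter_upwards [hFne, hdbar, (hF.of_le (m := 1) (by simp)).eventually (by simp),
        (hhc.of_le (m := 1) (by simp)).eventually (by simp),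
        (hkc.of_le (m := 1) (by simp)).eventually (by simp)] with y h1 h2 h3 h4 h5
      rw [planeDbar_mul (h5.differentiableAt (by simp)) (h4.differentiableAt (by simp)), hk,
        planeDbar_inner_left w (h3.differentiableAt (by simp)), h2, inner_smul_right, hh]
      field_simp
    have hd1 := hgc.differentiableAt (by simp)
    have hd2 := hvc.differentiableAt (by simp)
    have hd3 := hkc.differentiableAt (by simp)
    have hd4 := hhc.planeDbar.differentiableAt (by simp)
    -- Four terms vanish at `z`, in turn by `∂G ∈ ℂF ⊥ w`, by `∂̄F = |F|² G ⊥ v`, by `∂̄h = 0` and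
    -- by `k = 0`.
    rw [e.planeDel_eq, planeDel_add (hd1.fun_mul hd2) (hd3.fun_mul hd4), planeDel_mul hd1 hd2,
      planeDel_mul hd3 hd4, hk0, hh0, planeDel_inner_left w (hG.differentiableAt (by simp)), hdel,
      planeDel_inner_right v hFd, hdbar.self_of_nhds, inner_smul_right, inner_smul_left, hv]
    simp [inner_smul_right, inner_eq_zero_symm.1 horth, inner_eq_zero_symm.1 hw]
  have hp : ContDiffAt ℝ ∞ (fun y => rankOneProj (F y)) z :=
    (contDiffAt_rankOneProj h0).comp z hF
  rw [real_inner_comm]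
  have e1 := planeLaplacian_clm_comp (innerSL ℝ (rankOne w v + rankOne v w)) hp
  rw [innerSL_apply_apply] at e1
  rw [← e1]
  have e2 := planeLaplacian_clm_comp ((2 : ℝ) • Complex.reCLM) (hkc.mul hhc)
  rw [hθ, map_zero] at e2
  rw [← e2]
  congr 1
  ext y
  simp only [innerSL_apply_apply, inner_rankOneProj_rankOne_add]
  simp [hk, hh]

end Wirtinger

/-! ## The quaternionic structure of `ℂ^{2m}` -/

section Quaternionic

variable {m : ℕ}

/-- The other index of the pair `{2j, 2j + 1}`. -/
def pairSwap (k : Fin (2 * m)) : Fin (2 * m) :=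
  if h : k.val % 2 = 0 then ⟨k.val + 1, by omega⟩ else ⟨k.val - 1, by omega⟩

/-- The sign `-1` at even and `1` at odd indices. -/
def pairSign (k : Fin (2 * m)) : ℝ := if k.val % 2 = 0 then -1 else 1

lemma val_pairSwap (k : Fin (2 * m)) :
    (pairSwap k).val = if k.val % 2 = 0 then k.val + 1 else k.val - 1 := by
  unfold pairSwap
  split_ifs <;> rfl

lemma pairSwap_pairSwap (k : Fin (2 * m)) : pairSwap (pairSwap k) = k := by
  ext
  rw [val_pairSwap, val_pairSwap]
  split_ifs <;> omega

lemma pairSwap_ne (k : Fin (2 * m)) : pairSwap k ≠ k := by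
  intro h
  have := congrArg Fin.val h
  rw [val_pairSwap] at this
  split_ifs at this <;> omega

lemma pairSign_pairSwap (k : Fin (2 * m)) : pairSign (pairSwap k) = -pairSign k := by
  unfold pairSign
  rw [val_pairSwap]
  split_ifs <;> first | omega | simp

lemma pairSign_mul_self (k : Fin (2 * m)) : pairSign k * pairSign k = 1 := by
  unfold pairSign
  split_ifs <;> simp

/-- The quaternionic structure `(a, b) ↦ (-b̄, ā)` on pairs of coordinates. -/
def quatJ (F : EuclideanSpace ℂ (Fin (2 * m))) : EuclideanSpace ℂ (Fin (2 * m)) :=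
  WithLp.toLp 2 fun k => (pairSign k : ℂ) * (starRingEnd ℂ) (F (pairSwap k))

lemma quatJ_apply (F : EuclideanSpace ℂ (Fin (2 * m))) (k : Fin (2 * m)) :
    quatJ F k = (pairSign k : ℂ) * (starRingEnd ℂ) (F (pairSwap k)) := rfl

/-- Swapping the two indices of a pair flips the sign of its term, so the terms cancel in pairs. -/
lemma inner_quatJ (F : EuclideanSpace ℂ (Fin (2 * m))) : inner ℂ F (quatJ F) = 0 := by
  simp only [PiLp.inner_apply, RCLike.inner_apply, quatJ_apply]
  refine Finset.sum_involution (fun k _ => pairSwap k) (fun k _ => ?_) (fun k _ _ => pairSwap_ne k)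
    (fun k _ => Finset.mem_univ _) fun k _ => pairSwap_pairSwap k
  rw [pairSign_pairSwap, pairSwap_pairSwap]
  push_cast
  ring

lemma quatJ_smul (c : ℂ) (F : EuclideanSpace ℂ (Fin (2 * m))) :
    quatJ (c • F) = (starRingEnd ℂ) c • quatJ F := by
  ext k
  simp only [quatJ_apply, PiLp.smul_apply, smul_eq_mul, map_mul]
  ring

lemma sum_fin_two_mul (h : Fin (2 * m) → ℝ) :
    ∑ k, h k = ∑ j : Fin m, (h ⟨2 * j.val, by omega⟩ + h ⟨2 * j.val + 1, by omega⟩) := by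
  have h1 : ∑ j : Fin m, (h ⟨2 * j.val, by omega⟩ + h ⟨2 * j.val + 1, by omega⟩) =
      ∑ p : Fin m × Fin 2, h ⟨2 * p.1.val + p.2.val, by omega⟩ := by
    rw [Fintype.sum_prod_type]
    simp
  rw [h1]
  symm
  refine Fintype.sum_bijective (fun p : Fin m × Fin 2 =>
    (⟨2 * p.1.val + p.2.val, by omega⟩ : Fin (2 * m))) ⟨?_, ?_⟩ _ _ fun _ => rfl
  · rintro ⟨a, b⟩ ⟨a', b'⟩ hab
    have := congrArg Fin.val hab
    simp only at this
    ext
    · change a.val = a'.val; omega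
    · change b.val = b'.val; omega
  · intro k
    exact ⟨(⟨k.val / 2, by omega⟩, ⟨k.val % 2, by omega⟩), by ext; simp; omega⟩

end Quaternionic

/-! ## Spinors in local frames -/

section SpinFrames

open SpinStructure

variable {M : Type*} [TopologicalSpace M] {S : M → Type*} [∀ x, AddCommGroup (S x)]
  [∀ x, TopologicalSpace (S x)] [TopologicalSpace (TotalSpace ℂ S)] [FiberBundle ℂ S] {m : ℕ}

lemma frameCoeff_frame (x₀ : M) {x : M} (hx : x ∈ (trivializationAt ℂ S x₀).baseSet) :
    frameCoeff (frame x₀ : ∀ x, S x) x₀ x = 1 := by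
  rw [frameCoeff, frame, (trivializationAt ℂ S x₀).apply_mk_symm hx]

variable [ChartedSpace ℂ M]

lemma dzbar_eq (f : M → ℂ) (x : M) :
    dzbar f x = (surfaceDeriv f x 1 + Complex.I * surfaceDeriv f x Complex.I) / 2 := by
  have e : (tangentJ (tangentOne x)) = (Complex.I : ℂ) := mul_one Complex.I
  simp only [dzbar, e]
  rfl

/-- The coordinates `(ψ₁₊, ψ̄₁₋, …, ψₘ₊, ψ̄ₘ₋)` near `x₀`, with respect to the holomorphic frame at
`x₀`. -/
def spinorFrameVec (ψ : Fin m → Spinor M S) (x₀ x : M) : EuclideanSpace ℂ (Fin (2 * m)) :=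
  WithLp.toLp 2 fun k => frameCoeff (fun y => spinorCoord ψ y k) x₀ x

lemma spinorCoord_of_even {ψ : Fin m → Spinor M S} {x : M} {j : Fin m} {k : Fin (2 * m)}
    (h : k.val = 2 * j.val) : spinorCoord ψ x k = (ψ j).plus x := by
  obtain ⟨k, hk⟩ := k
  obtain rfl : k = 2 * j.val := h
  simp [spinorCoord]

lemma spinorCoord_of_odd {ψ : Fin m → Spinor M S} {x : M} {j : Fin m} {k : Fin (2 * m)}
    (h : k.val = 2 * j.val + 1) : spinorCoord ψ x k = ((ψ j).minus x).unbar := by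
  obtain ⟨k, hk⟩ := k
  obtain rfl : k = 2 * j.val + 1 := h
  have e : (2 * j.val + 1) / 2 = j.val := by omega
  simp [spinorCoord, Nat.add_mod, e]

lemma contMDiffAt_spinorFrameVec (ψ : Fin m → Spinor M S) (x₀ : M) :
    ContMDiffAt 𝓘(ℝ, ℂ) 𝓘(ℝ, EuclideanSpace ℂ (Fin (2 * m))) ∞ (spinorFrameVec ψ x₀) x₀ := by
  have h : ∀ k, ContMDiffAt 𝓘(ℝ, ℂ) 𝓘(ℝ, ℂ) ∞
      (frameCoeff (fun y => spinorCoord ψ y k) x₀) x₀ := by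
    intro k
    refine (Bundle.contMDiffAt_section x₀).1 ?_
    unfold spinorCoord
    split_ifs
    · exact (ψ _).smooth_plus x₀
    · exact (ψ _).smooth_minus x₀
  have h2 : ContMDiffAt 𝓘(ℝ, ℂ) 𝓘(ℝ, Fin (2 * m) → ℂ) ∞
      (fun x k => frameCoeff (fun y => spinorCoord ψ y k) x₀ x) x₀ := contMDiffAt_pi_space.2 h
  exact ((PiLp.continuousLinearEquiv 2 ℝ (fun _ : Fin (2 * m) => ℂ)).symm.contDiff.contMDiff
    |>.contMDiffAt).comp x₀ h2

variable [∀ x, Module ℂ (S x)] [VectorBundle ℂ ℂ S]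

lemma trivialization_smul (x₀ : M) {x : M} (hx : x ∈ (trivializationAt ℂ S x₀).baseSet) (c : ℂ)
    (v : S x) : (trivializationAt ℂ S x₀ ⟨x, c • v⟩).2 = c * (trivializationAt ℂ S x₀ ⟨x, v⟩).2 :=
  ((trivializationAt ℂ S x₀).linear ℂ hx).map_smul c v

lemma frame_spec (x₀ : M) {x : M} (hx : x ∈ (trivializationAt ℂ S x₀).baseSet) (v : S x) :
    (trivializationAt ℂ S x₀ ⟨x, v⟩).2 • (frame x₀ x : S x) = v := by
  have h := (trivializationAt ℂ S x₀).symm_apply_apply_mk hx v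
  rw [frame, ← (trivializationAt ℂ S x₀).symmL_apply (R := ℂ) hx, ← map_smul, smul_eq_mul, mul_one,
    (trivializationAt ℂ S x₀).symmL_apply (R := ℂ) hx]
  exact h

lemma frameCoeff_change (s : ∀ x, S x) (x₀ y : M) {x : M}
    (hx : x ∈ (trivializationAt ℂ S x₀).baseSet) (hy : x ∈ (trivializationAt ℂ S y).baseSet) :
    frameCoeff s y x = frameCoeff s x₀ x * frameCoeff (frame x₀ : ∀ x, S x) y x := by
  conv_lhs => rw [frameCoeff, ← frame_spec x₀ hx (s x), trivialization_smul y hy]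
  rfl

lemma spinorFrameVec_change (ψ : Fin m → Spinor M S) (x₀ y : M) {x : M}
    (hx : x ∈ (trivializationAt ℂ S x₀).baseSet) (hy : x ∈ (trivializationAt ℂ S y).baseSet) :
    spinorFrameVec ψ y x = frameCoeff (frame x₀ : ∀ x, S x) y x • spinorFrameVec ψ x₀ x := by
  ext k
  simp only [spinorFrameVec, PiLp.smul_apply, smul_eq_mul]
  rw [frameCoeff_change _ x₀ y hx hy, mul_comm]

variable [IsManifold 𝓘(ℂ) ω M]

lemma contMDiffAt_frame [ContMDiffVectorBundle ω ℂ S 𝓘(ℂ)] (x₀ : M) {y : M}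
    (hy : y ∈ (trivializationAt ℂ S x₀).baseSet) :
    ContMDiffAt 𝓘(ℂ) (𝓘(ℂ).prod 𝓘(ℂ)) ω
      (fun x => TotalSpace.mk' ℂ x (frame x₀ x : S x)) y := by
  rw [Trivialization.contMDiffAt_section_iff (trivializationAt ℂ S x₀) hy]
  refine contMDiffAt_const (c := (1 : ℂ)) |>.congr_of_eventuallyEq ?_
  filter_upwards [(trivializationAt ℂ S x₀).open_baseSet.mem_nhds hy] with x hx
  exact frameCoeff_frame x₀ hx

lemma mdifferentiableAt_frameCoeff_frame [ContMDiffVectorBundle ω ℂ S 𝓘(ℂ)] (x₀ : M) {y : M}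
    (hy : y ∈ (trivializationAt ℂ S x₀).baseSet) :
    MDifferentiableAt 𝓘(ℂ) 𝓘(ℂ) (frameCoeff (frame x₀ : ∀ x, S x) y) y :=
  ((Bundle.contMDiffAt_section y).1 (contMDiffAt_frame x₀ hy)).mdifferentiableAt (by simp)

/-- The Wirtinger derivative in a chart, in terms of the one in the preferred chart. -/
lemma planeDbar_comp_chartAt_symm (i : M) {z : ℂ} (hz : z ∈ (chartAt ℂ i).target) {f : M → ℂ}
    (hf : MDifferentiableAt 𝓘(ℝ, ℂ) 𝓘(ℝ, ℂ) f ((chartAt ℂ i).symm z)) :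
    planeDbar (fun w => f ((chartAt ℂ i).symm w)) z =
      2 * (starRingEnd ℂ) (chartVelocity (chartAt ℂ i) z) * dzbar f ((chartAt ℂ i).symm z) := by
  rw [planeDbar, fderiv_comp_chartAt_symm i hz hf, fderiv_comp_chartAt_symm i hz hf, dzbar_eq]
  set c := chartVelocity (chartAt ℂ i) z
  set L := surfaceDeriv f ((chartAt ℂ i).symm z)
  have h1 : L (1 * c) = c.re * L 1 + c.im * L Complex.I := by
    have : 1 * c = c.re • (1 : ℂ) + c.im • Complex.I := by apply Complex.ext <;> simp
    rw [this, map_add, map_smul, map_smul]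
    simp
  have h2 : L (Complex.I * c) = -c.im * L 1 + c.re * L Complex.I := by
    have : Complex.I * c = (-c.im) • (1 : ℂ) + c.re • Complex.I := by apply Complex.ext <;> simp
    rw [this, map_add, map_smul, map_smul]
    simp
  have h3 : (starRingEnd ℂ) c = c.re - c.im * Complex.I := by
    apply Complex.ext <;> simp
  rw [h1, h2, h3, smul_eq_mul]
  linear_combination (c.im * L Complex.I) * Complex.I_sq

/-- A holomorphic factor can be taken out of `∂/∂z̄`. -/
lemma dzbar_mul_of_holomorphic {f h : M → ℂ} {x : M}
    (hf : MDifferentiableAt 𝓘(ℝ, ℂ) 𝓘(ℝ, ℂ) f x) (hh : MDifferentiableAt 𝓘(ℂ) 𝓘(ℂ) h x) :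
    dzbar (fun y => f y * h y) x = dzbar f x * h x := by
  obtain ⟨L, hL⟩ : ∃ L : ℂ →L[ℂ] ℂ, HasMFDerivAt 𝓘(ℂ) 𝓘(ℂ) h x L := ⟨_, hh.hasMFDerivAt⟩
  have h1 := hL.restrictScalars_complex
  have h2 : HasMFDerivAt 𝓘(ℝ, ℂ) 𝓘(ℝ, ℂ) f x (surfaceDeriv f x) := hf.hasMFDerivAt
  have h3 : HasMFDerivAt 𝓘(ℝ, ℂ) 𝓘(ℝ, ℂ) (fun y => f y * h y) x
      (f x • (L.restrictScalars ℝ : ℂ →L[ℝ] ℂ) + h x • surfaceDeriv f x : ℂ →L[ℝ] ℂ) :=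
    h2.mul h1
  have h4 : surfaceDeriv (fun y => f y * h y) x =
      (f x • (L.restrictScalars ℝ : ℂ →L[ℝ] ℂ) + h x • surfaceDeriv f x : ℂ →L[ℝ] ℂ) := h3.mfderiv
  have h5 : L Complex.I = Complex.I * L 1 := by
    rw [← smul_eq_mul, ← map_smul, smul_eq_mul, mul_one]
  rw [dzbar_eq, dzbar_eq, h4]
  simp only [add_apply, smul_apply, ContinuousLinearMap.coe_restrictScalars', smul_eq_mul, h5]
  linear_combination (f x * L 1 / 2) * Complex.I_sq

variable [ContMDiffVectorBundle ω ℂ S 𝓘(ℂ)] (σ : SpinStructure M S) (g : ConformalMetric M)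

lemma sqCoeff_smul (x : M) (c : ℂ) (s : S x) : σ.sqCoeff x (c • s) = c ^ 2 * σ.sqCoeff x s := by
  unfold sqCoeff
  rw [TensorProduct.smul_tmul_smul, map_smul, sq]
  rfl

lemma iso_apply_eq (x : M) (s : S x) (c : ℂ) :
    σ.iso x (s ⊗ₜ[ℂ] s) (c : ℂ) = c * σ.sqCoeff x s := by
  set L : ℂ →L[ℂ] ℂ := σ.iso x (s ⊗ₜ[ℂ] s)
  have : L c = c * L 1 := by rw [← smul_eq_mul, ← map_smul, smul_eq_mul, mul_one]
  exact this

/-- The normalization `Σ |ψ_j|² = 1` in the frame at `x`. -/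
lemma norm_spinorVec {ψ : Fin m → Spinor M S} {x : M}
    (hnorm : ∑ j, σ.spinorNormSq g (ψ j) x = 1) :
    ‖σ.sqCoeff x (frame x x)‖ / √(g.normSq x (tangentOne x)) * ‖spinorVec ψ x‖ ^ 2 = 1 := by
  rw [← hnorm, EuclideanSpace.norm_sq_eq, sum_fin_two_mul, Finset.mul_sum]
  refine Finset.sum_congr rfl fun j _ => ?_
  have hx := FiberBundle.mem_baseSet_trivializationAt ℂ S x
  have key : ∀ v : S x, σ.normSq g x v = ‖σ.sqCoeff x (frame x x)‖ /
      √(g.normSq x (tangentOne x)) * ‖(trivializationAt ℂ S x ⟨x, v⟩).2‖ ^ 2 := by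
    intro v
    conv_lhs => rw [normSq, ← frame_spec x hx v, sqCoeff_smul, norm_mul, norm_pow]
    ring
  rw [spinorNormSq, key, key, mul_add, ← spinorCoord_of_even (k := ⟨2 * j.val, by omega⟩) rfl,
    ← spinorCoord_of_odd (k := ⟨2 * j.val + 1, by omega⟩) rfl]
  rfl

/-- The eigenvalue equation in the preferred chart and frame. -/
lemma dzbar_spinorVec {ψ : Fin m → Spinor M S} {lam : ℝ} {x : M}
    (heigen : ∀ j, σ.dirac g (ψ j) x = (lam : ℂ) • ((ψ j).plus x, (ψ j).minus x))
    (hnorm : ∑ j, σ.spinorNormSq g (ψ j) x = 1) (k : Fin (2 * m)) :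
    dzbar (frameCoeff (fun y => spinorCoord ψ y k) x) x =
      lam / 2 * (starRingEnd ℂ) (σ.sqCoeff x (frame x x)) *
        inner ℂ (spinorVec ψ x) (spinorVec ψ x) * quatJ (spinorVec ψ x) k := by
  have hx := FiberBundle.mem_baseSet_trivializationAt ℂ S x
  have hN := norm_spinorVec σ g hnorm
  set A := σ.sqCoeff x (frame x x) with hA
  set n := √(g.normSq x (tangentOne x)) with hn
  set F := spinorVec ψ x with hF
  have hAn : ‖A‖ / n ≠ 0 := left_ne_zero_of_mul_eq_one hN
  have hA0 : A ≠ 0 := by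
    rintro h
    rw [h, norm_zero, zero_div] at hAn
    exact hAn rfl
  -- Here the normalization eliminates the metric: `‖A‖ / n = |e|²` has inverse `⟨F, F⟩`.
  have hsolve : ∀ d r : ℂ, ((‖A‖ / n : ℝ) : ℂ) * d / (starRingEnd ℂ) A = r →
      d = (starRingEnd ℂ) A * inner ℂ F F * r := by
    intro d r h
    have hN' : ((‖A‖ / n : ℝ) : ℂ) * inner ℂ F F = 1 := by
      rw [inner_self_eq_norm_sq_to_K]
      simpa using congrArg (fun r : ℝ => (r : ℂ)) hN
    have hA0' : (starRingEnd ℂ) A ≠ 0 := by simpa using hA0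
    rw [← h]
    field_simp
    linear_combination (-d) * hN'
  have hcoef : ∀ a b : ℂ, a • (frame x x : S x) = b • (frame x x : S x) → a = b := by
    intro a b h
    have h1 := congrArg (fun v : S x => (trivializationAt ℂ S x ⟨x, v⟩).2) h
    simp only [trivialization_smul x hx] at h1
    have h2 : (trivializationAt ℂ S x ⟨x, (frame x x : S x)⟩).2 = 1 := frameCoeff_frame x hx
    simpa [h2] using h1
  have hdb : ∀ s : ∀ y, S y, (σ.dbar g s x).unbar =
      (starRingEnd ℂ) (((‖A‖ / n : ℝ) : ℂ) * dzbar (frameCoeff s x) x / (starRingEnd ℂ) A) •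
        (frame x x : S x) := fun s => rfl
  have hconj2 : (starRingEnd ℂ) (2 : ℂ) = 2 := Complex.conj_ofNat 2
  have hp : ∀ j, dzbar (frameCoeff (fun y => ((ψ j).minus y).unbar) x) x =
      (starRingEnd ℂ) A * inner ℂ F F *
        (lam / 2 * (starRingEnd ℂ) (trivializationAt ℂ S x ⟨x, (ψ j).plus x⟩).2) := by
    intro j
    have h1 : (2 : ℂ) • (σ.dbar g (fun y => ((ψ j).minus y).unbar) x).unbar =
        (lam : ℂ) • (ψ j).plus x := congrArg Prod.fst (heigen j)
    rw [hdb, smul_smul, ← frame_spec x hx ((ψ j).plus x), smul_smul] at h1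
    have h2 := congrArg (starRingEnd ℂ) (hcoef _ _ h1)
    simp only [map_mul, Complex.conj_conj, hconj2, Complex.conj_ofReal] at h2
    exact hsolve _ _ (by linear_combination h2 / 2)
  have hm : ∀ j, dzbar (frameCoeff (ψ j).plus x) x =
      (starRingEnd ℂ) A * inner ℂ F F * (-(lam / 2) *
        (starRingEnd ℂ) (trivializationAt ℂ S x ⟨x, ((ψ j).minus x).unbar⟩).2) := by
    intro j
    -- The second component lies in the conjugate space, so scalars act on the underlying vector
    -- through their conjugates.
    have h1 : (starRingEnd ℂ) (2 : ℂ) • (-(σ.dbar g (ψ j).plus x).unbar) =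
        (starRingEnd ℂ) (lam : ℂ) • ((ψ j).minus x).unbar := congrArg Prod.snd (heigen j)
    rw [hdb, ← neg_smul, smul_smul, ← frame_spec x hx ((ψ j).minus x).unbar, smul_smul] at h1
    have h2 := congrArg (starRingEnd ℂ) (hcoef _ _ h1)
    simp only [map_mul, map_neg, Complex.conj_conj, hconj2, Complex.conj_ofReal] at h2
    exact hsolve _ _ (by linear_combination -h2 / 2)
  rw [quatJ_apply]
  have hF' : ∀ l, F l = (trivializationAt ℂ S x ⟨x, spinorCoord ψ x l⟩).2 := fun l => rfl
  have hj : k.val / 2 < m := by omega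
  rw [hF']
  by_cases hk : k.val % 2 = 0
  · have h1 : k.val = 2 * (⟨k.val / 2, hj⟩ : Fin m).val := by
      change k.val = 2 * (k.val / 2); omega
    have h2 : (pairSwap k).val = 2 * (⟨k.val / 2, hj⟩ : Fin m).val + 1 := by
      rw [val_pairSwap, if_pos hk]; change _ = 2 * (k.val / 2) + 1; omega
    simp only [spinorCoord_of_even h1, spinorCoord_of_odd h2, pairSign, hk, if_true]
    rw [hm]
    push_cast
    ring
  · have h1 : k.val = 2 * (⟨k.val / 2, hj⟩ : Fin m).val + 1 := by
      change k.val = 2 * (k.val / 2) + 1; omega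
    have h2 : (pairSwap k).val = 2 * (⟨k.val / 2, hj⟩ : Fin m).val := by
      rw [val_pairSwap, if_neg hk]; change _ = 2 * (k.val / 2); omega
    simp only [spinorCoord_of_odd h1, spinorCoord_of_even h2, pairSign, hk, if_false]
    rw [hp]
    push_cast
    ring

end SpinFrames

/-! ## Harmonicity -/

section Harmonicity

variable {M : Type*} [TopologicalSpace M] [ChartedSpace ℂ M] [IsManifold 𝓘(ℂ) ω M]
  {S : M → Type*} [∀ x, AddCommGroup (S x)] [∀ x, Module ℂ (S x)]
  [∀ x, TopologicalSpace (S x)] [TopologicalSpace (TotalSpace ℂ S)] [FiberBundle ℂ S]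
  [VectorBundle ℂ ℂ S] [ContMDiffVectorBundle ω ℂ S 𝓘(ℂ)] (σ : SpinStructure M S)
  (g : ConformalMetric M) {m : ℕ}

open SpinStructure

lemma Filter.EventuallyEq.planeLaplacian_eq {W : Type*} [NormedAddCommGroup W] [NormedSpace ℝ W]
    {p q : ℂ → W} {z : ℂ} (h : p =ᶠ[𝓝 z] q) : planeLaplacian p z = planeLaplacian q z := by
  have h1 : ∀ v, (fun w => fderiv ℝ p w v) =ᶠ[𝓝 z] fun w => fderiv ℝ q w v := fun v => by
    filter_upwards [h.fderiv (𝕜 := ℝ)] with w hw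
    rw [hw]
  simp only [planeLaplacian, (h1 _).fderiv_eq]

lemma planeDel_const_mul_conj {f : ℂ → ℂ} {z : ℂ} (c : ℂ) (hf : DifferentiableAt ℝ f z) :
    planeDel (fun w => c * (starRingEnd ℂ) (f w)) z = c * (starRingEnd ℂ) (planeDbar f z) := by
  have h : HasFDerivAt (fun w => c * (starRingEnd ℂ) (f w))
      (c • (Complex.conjCLE : ℂ →L[ℝ] ℂ).comp (fderiv ℝ f z)) z :=
    ((Complex.conjCLE : ℂ →L[ℝ] ℂ).hasFDerivAt.comp z hf.hasFDerivAt).const_mul c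
  rw [planeDel, planeDbar, h.fderiv]
  simp
  ring

lemma planeDbar_of_differentiableAt {f : ℂ → ℂ} {z : ℂ} (hf : DifferentiableAt ℂ f z) :
    planeDbar f z = 0 := by
  have h := hf.hasDerivAt.hasFDerivAt.restrictScalars ℝ
  rw [planeDbar, h.fderiv]
  simp
  linear_combination (deriv f z) * Complex.I_sq

/-! ### Wirtinger derivatives by components -/

section Components

variable {N : ℕ} {F : ℂ → EuclideanSpace ℂ (Fin N)} {z : ℂ}

lemma fderiv_euclidean_apply (hF : DifferentiableAt ℝ F z) (k : Fin N) (v : ℂ) :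
    fderiv ℝ (fun w => F w k) z v = fderiv ℝ F z v k := by
  have h := (((EuclideanSpace.proj k : EuclideanSpace ℂ (Fin N) →L[ℂ] ℂ).restrictScalars
    ℝ).hasFDerivAt.comp z hF.hasFDerivAt).fderiv
  exact congrArg (fun L : ℂ →L[ℝ] ℂ => L v) h

lemma planeDbar_euclidean_apply (hF : DifferentiableAt ℝ F z) (k : Fin N) :
    planeDbar F z k = planeDbar (fun w => F w k) z := by
  simp [planeDbar, fderiv_euclidean_apply hF]

lemma planeDel_euclidean_apply (hF : DifferentiableAt ℝ F z) (k : Fin N) :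
    planeDel F z k = planeDel (fun w => F w k) z := by
  simp [planeDel, fderiv_euclidean_apply hF]

end Components

/-- The coefficient of `e ⊗ e` with respect to `dz` is holomorphic, for a holomorphic frame `e` of
the spin structure and the coordinate `z` of a chart. -/
lemma contDiffAt_iso_frame (i : M) {z₀ : ℂ} (hz₀ : z₀ ∈ (chartAt ℂ i).target) {x₀ : M}
    (hx₀ : (chartAt ℂ i).symm z₀ = x₀) :
    ContDiffAt ℂ ω (fun z => chartVelocity (chartAt ℂ i) z *
      σ.sqCoeff ((chartAt ℂ i).symm z) (frame x₀ ((chartAt ℂ i).symm z))) z₀ := by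
  have hs : ContMDiffAt 𝓘(ℂ) 𝓘(ℂ) ω (chartAt ℂ i).symm z₀ :=
    (contMDiffOn_chart_symm (I := 𝓘(ℂ)) (x := i) (n := ω)).contMDiffAt
      ((chartAt ℂ i).open_target.mem_nhds hz₀)
  have hfr := contMDiffAt_frame (S := S) x₀ (FiberBundle.mem_baseSet_trivializationAt ℂ S x₀)
  have hiso := σ.holomorphic (frame x₀) (frame x₀) x₀ hfr hfr
  rw [← hx₀] at hiso
  have hϕ := hiso.comp z₀ hs
  rw [hx₀] at hϕ
  have hone : ContMDiffAt 𝓘(ℂ) 𝓘(ℂ).tangent ω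
      (fun z : ℂ => (TotalSpace.mk' ℂ z (1 : ℂ) : TangentBundle 𝓘(ℂ) ℂ)) z₀ := by
    refine contMDiffAt_totalSpace.2 ⟨contMDiffAt_id, ?_⟩
    simp only [trivializationAt_model_space_apply]
    exact contMDiffAt_const
  -- The inverse chart pushes the constant field `1` forward to a holomorphic field along it;
  -- pairing with the holomorphic section `e ⊗ e` of `K` gives the coefficient.
  have hv : ContMDiffAt 𝓘(ℂ) 𝓘(ℂ).tangent ω
      (fun z : ℂ => (TotalSpace.mk' ℂ ((chartAt ℂ i).symm z)
        (mfderiv 𝓘(ℂ) 𝓘(ℂ) (chartAt ℂ i).symm z (1 : ℂ)) : TangentBundle 𝓘(ℂ) M)) z₀ :=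
    ContMDiffAt.clm_apply_of_inCoordinates (hs.mfderiv_const (m := ω) (by simp)) hone hs
  have happ := ContMDiffAt.clm_bundle_apply (E₂ := fun _ : M => ℂ) (b := (chartAt ℂ i).symm)
    (v := fun z => mfderiv 𝓘(ℂ) 𝓘(ℂ) (chartAt ℂ i).symm z (1 : ℂ)) hϕ hv
  have h2 := (contMDiffAt_totalSpace.1 happ).2.contDiffAt
  refine h2.congr_of_eventuallyEq ?_
  filter_upwards [(chartAt ℂ i).open_target.mem_nhds hz₀] with z hz
  have hvel : chartVelocity (chartAt ℂ i) z = mfderiv 𝓘(ℂ) 𝓘(ℂ) (chartAt ℂ i).symm z (1 : ℂ) := by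
    obtain ⟨L, hL⟩ : ∃ L : ℂ →L[ℂ] ℂ, HasMFDerivAt 𝓘(ℂ) 𝓘(ℂ) (chartAt ℂ i).symm z L :=
      ⟨_, (mdifferentiableAt_chartAt_symm i hz).hasMFDerivAt⟩
    rw [chartVelocity, hL.restrictScalars_complex.mfderiv, hL.mfderiv]
    rfl
  rw [← iso_apply_eq, hvel]
  rfl

/-- The eigenvalue equation in a chart and a holomorphic frame. -/
lemma planeDbar_spinorFrameVec {ψ : Fin m → Spinor M S} {lam : ℝ}
    (heigen : ∀ j x, σ.dirac g (ψ j) x = (lam : ℂ) • ((ψ j).plus x, (ψ j).minus x))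
    (hnorm : ∀ x, ∑ j, σ.spinorNormSq g (ψ j) x = 1) (i : M) {z : ℂ}
    (hz : z ∈ (chartAt ℂ i).target) {x₀ y : M} (hy : (chartAt ℂ i).symm z = y)
    (hyx : y ∈ (trivializationAt ℂ S x₀).baseSet)
    (hd : MDifferentiableAt 𝓘(ℝ, ℂ) 𝓘(ℝ, EuclideanSpace ℂ (Fin (2 * m)))
      (spinorFrameVec ψ x₀) y) :
    planeDbar (fun w => spinorFrameVec ψ x₀ ((chartAt ℂ i).symm w)) z =
      (inner ℂ (spinorFrameVec ψ x₀ y) (spinorFrameVec ψ x₀ y) : ℂ) •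
        ((lam * (starRingEnd ℂ) (chartVelocity (chartAt ℂ i) z * σ.sqCoeff y (frame x₀ y))) •
          quatJ (spinorFrameVec ψ x₀ y)) := by
  have hyy := FiberBundle.mem_baseSet_trivializationAt ℂ S y
  subst hy
  set y := (chartAt ℂ i).symm z with hy
  have hFd : DifferentiableAt ℝ (fun w => spinorFrameVec ψ x₀ ((chartAt ℂ i).symm w)) z :=
    mdifferentiableAt_iff_differentiableAt.1
      (hd.comp z ((contMDiffAt_chartAt_symm i hz).mdifferentiableAt (by simp)))
  ext k
  have hdk : MDifferentiableAt 𝓘(ℝ, ℂ) 𝓘(ℝ, ℂ)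
      (frameCoeff (fun y => spinorCoord ψ y k) x₀) y :=
    (((EuclideanSpace.proj k : EuclideanSpace ℂ (Fin (2 * m)) →L[ℂ] ℂ).restrictScalars
      ℝ).differentiableAt.mdifferentiableAt).comp y hd
  -- The pointwise equation is known only in the frame preferred at `y`. The change to the frame at
  -- `x₀` is holomorphic, so it passes through `∂̄` as the factor `κ`.
  set κ := frameCoeff (frame x₀ : ∀ x, S x) y y with hκ
  have hκ0 : κ ≠ 0 := by
    have h := frameCoeff_change (frame y : ∀ x, S x) x₀ y hyx hyy
    rw [frameCoeff_frame y hyy] at h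
    exact right_ne_zero_of_mul (h ▸ one_ne_zero)
  have hframe : (frame x₀ y : S y) = κ • frame y y := (frame_spec y hyy _).symm
  have hvec : spinorVec ψ y = κ • spinorFrameVec ψ x₀ y := spinorFrameVec_change ψ x₀ y hyx hyy
  have heq := dzbar_spinorVec σ g (fun j => heigen j y) (hnorm y) k
  have hloc : frameCoeff (fun y => spinorCoord ψ y k) y =ᶠ[𝓝 y]
      fun x => frameCoeff (fun y => spinorCoord ψ y k) x₀ x *
        frameCoeff (frame x₀ : ∀ x, S x) y x := by
    filter_upwards [(trivializationAt ℂ S x₀).open_baseSet.mem_nhds hyx,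
      (trivializationAt ℂ S y).open_baseSet.mem_nhds hyy] with x h1 h2
    exact frameCoeff_change _ x₀ y h1 h2
  have hdz : dzbar (frameCoeff (fun y => spinorCoord ψ y k) y) y =
      dzbar (frameCoeff (fun y => spinorCoord ψ y k) x₀) y * κ := by
    rw [← dzbar_mul_of_holomorphic hdk (mdifferentiableAt_frameCoeff_frame x₀ hyx)]
    rw [dzbar, dzbar, hloc.mfderiv_eq]
    rfl
  rw [hdz, hvec, quatJ_smul, inner_smul_left, inner_smul_right] at heq
  rw [planeDbar_euclidean_apply hFd]
  have h1 := planeDbar_comp_chartAt_symm i hz hdk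
  refine h1.trans ?_
  rw [hframe, sqCoeff_smul]
  simp only [PiLp.smul_apply, smul_eq_mul, map_mul, map_pow] at heq ⊢
  -- One `κ` cancels. The remaining `κ̄²`, from the inner product and from the antilinear `quatJ`,
  -- is the change of the conjugate coefficient of `e ⊗ e`.
  refine mul_right_cancel₀ hκ0 ?_
  rw [mul_assoc, ← hy, heq]
  ring

/-- The tangential component of the Laplacian of the map given by the spinors vanishes. -/
lemma inner_planeLaplacian_spinorFrameVec {ψ : Fin m → Spinor M S} {lam : ℝ}
    (heigen : ∀ j x, σ.dirac g (ψ j) x = (lam : ℂ) • ((ψ j).plus x, (ψ j).minus x))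
    (hnorm : ∀ x, ∑ j, σ.spinorNormSq g (ψ j) x = 1) (i : M) {z₀ : ℂ}
    (hz₀ : z₀ ∈ (chartAt ℂ i).target) {x₀ : M} (hx₀ : (chartAt ℂ i).symm z₀ = x₀)
    {c : ℂ} {w : EuclideanSpace ℂ (Fin (2 * m))} (hw : inner ℂ (spinorFrameVec ψ x₀ x₀) w = 0) :
    inner ℝ (planeLaplacian (fun z => rankOneProj (spinorFrameVec ψ x₀ ((chartAt ℂ i).symm z))) z₀)
      (rankOne w (c • spinorFrameVec ψ x₀ x₀) + rankOne (c • spinorFrameVec ψ x₀ x₀) w) = 0 := by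
  set F : ℂ → EuclideanSpace ℂ (Fin (2 * m)) :=
    fun z => spinorFrameVec ψ x₀ ((chartAt ℂ i).symm z) with hFdef
  set a : ℂ → ℂ := fun z => chartVelocity (chartAt ℂ i) z *
    σ.sqCoeff ((chartAt ℂ i).symm z) (frame x₀ ((chartAt ℂ i).symm z)) with hadef
  set G : ℂ → EuclideanSpace ℂ (Fin (2 * m)) :=
    fun z => (lam * (starRingEnd ℂ) (a z)) • quatJ (F z) with hGdef
  have hF0 : F z₀ = spinorFrameVec ψ x₀ x₀ := by rw [hFdef]; simp only [hx₀]
  have hsm := contMDiffAt_spinorFrameVec ψ x₀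
  have hF : ContDiffAt ℝ ∞ F z₀ := by
    rw [← hx₀] at hsm
    have := (hsm.comp z₀ (contMDiffAt_chartAt_symm i hz₀)).contDiffAt
    rwa [hx₀] at this
  have haω := contDiffAt_iso_frame σ i hz₀ hx₀
  have ha : ContDiffAt ℝ ∞ a z₀ := (haω.restrict_scalars ℝ).of_le (by simp)
  have hFk : ∀ k, ContDiffAt ℝ ∞ (fun z => F z k) z₀ := fun k =>
    ((EuclideanSpace.proj k : EuclideanSpace ℂ (Fin (2 * m)) →L[ℂ] ℂ).restrictScalars
      ℝ).contDiff.contDiffAt.comp z₀ hF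
  have hGk : ∀ k z, G z k = (lam * pairSign k : ℂ) *
      (starRingEnd ℂ) (a z * F z (pairSwap k)) := by
    intro k z
    simp only [hGdef, PiLp.smul_apply, smul_eq_mul, quatJ_apply, map_mul]
    ring
  have hG : ContDiffAt ℝ ∞ G z₀ := by
    have hcomp : ContDiffAt ℝ ∞ (fun z k => G z k) z₀ := by
      rw [contDiffAt_pi]
      intro k
      simp only [hGk]
      exact contDiffAt_const.mul (Complex.conjCLE.contDiff.contDiffAt.comp z₀ (ha.mul (hFk _)))
    exact (PiLp.continuousLinearEquiv 2 ℝ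
      (fun _ : Fin (2 * m) => ℂ)).symm.contDiff.contDiffAt.comp z₀ hcomp
  have hdbar : ∀ᶠ z in 𝓝 z₀, planeDbar F z = (inner ℂ (F z) (F z) : ℂ) • G z := by
    have hcont := (chartAt ℂ i).continuousAt_symm hz₀
    have h1 : ∀ᶠ x in 𝓝 ((chartAt ℂ i).symm z₀),
        MDifferentiableAt 𝓘(ℝ, ℂ) 𝓘(ℝ, EuclideanSpace ℂ (Fin (2 * m)))
          (spinorFrameVec ψ x₀) x := by
      rw [hx₀]
      have : IsManifold 𝓘(ℝ, ℂ) 1 M := IsManifold.of_le (n := ω) (by simp)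
      have hsm1 : ContMDiffAt 𝓘(ℝ, ℂ) 𝓘(ℝ, EuclideanSpace ℂ (Fin (2 * m))) 1
          (spinorFrameVec ψ x₀) x₀ := ContMDiffAt.of_le hsm (by simp)
      filter_upwards [(contMDiffAt_iff_contMDiffAt_nhds (by simp)).1 hsm1] with x hx
      exact hx.mdifferentiableAt (by simp)
    have h2 : ∀ᶠ x in 𝓝 ((chartAt ℂ i).symm z₀), x ∈ (trivializationAt ℂ S x₀).baseSet := by
      rw [hx₀]
      exact (trivializationAt ℂ S x₀).open_baseSet.mem_nhds
        (FiberBundle.mem_baseSet_trivializationAt ℂ S x₀)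
    filter_upwards [(chartAt ℂ i).open_target.mem_nhds hz₀, hcont.eventually h1,
      hcont.eventually h2] with z hz hz1 hz2
    exact planeDbar_spinorFrameVec σ g heigen hnorm i hz rfl hz2 hz1
  have h0 : F z₀ ≠ 0 := by
    rw [hF0]
    exact spinorVec_ne_zero σ g ψ hnorm x₀
  have horth : inner ℂ (F z₀) (G z₀) = 0 := by
    rw [hGdef, inner_smul_right, inner_quatJ, mul_zero]
  -- `∂` of a conjugate is the conjugate of `∂̄`, which passes by the holomorphic `a` and turns `F`
  -- into `|F|² G`. The second application of `quatJ` returns a multiple of `F`, with the sign from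
  -- `J² = -1`.
  have hdel : planeDel G z₀ = (-(lam ^ 2 * (starRingEnd ℂ) (a z₀) * a z₀ *
      (starRingEnd ℂ) (inner ℂ (F z₀) (F z₀)))) • F z₀ := by
    ext k
    rw [planeDel_euclidean_apply (hG.differentiableAt (by simp))]
    simp only [hGk]
    have had := ha.differentiableAt (by simp)
    have hfd := (hFk (pairSwap k)).differentiableAt (by simp)
    rw [planeDel_const_mul_conj _ (had.fun_mul hfd), planeDbar_mul had hfd,
      planeDbar_of_differentiableAt (haω.differentiableAt (by simp)),
      ← planeDbar_euclidean_apply (hF.differentiableAt (by simp)), hdbar.self_of_nhds]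
    simp only [PiLp.smul_apply, smul_eq_mul, hGk, pairSwap_pairSwap, pairSign_pairSwap, map_mul,
      map_add, Complex.conj_conj, Complex.conj_ofReal, Complex.ofReal_neg, map_neg, map_zero]
    have hs : (pairSign k : ℂ) * pairSign k = 1 := by exact_mod_cast pairSign_mul_self k
    linear_combination (-(lam ^ 2 * (starRingEnd ℂ) (a z₀) * a z₀ *
      (starRingEnd ℂ) (inner ℂ (F z₀) (F z₀))) * F z₀ k) * hs
  rw [← hF0] at hw ⊢
  exact inner_planeLaplacian_rankOneProj hF hG h0 hdbar horth hdel hw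

end Harmonicity

end

theorem theorem1 {M : Type*} [TopologicalSpace M] [T2Space M] [CompactSpace M]
    [ChartedSpace ℂ M] [IsManifold 𝓘(ℂ) ω M] (g : ConformalMetric M)
    {S : M → Type*} [∀ x, AddCommGroup (S x)] [∀ x, Module ℂ (S x)]
    [∀ x, TopologicalSpace (S x)] [TopologicalSpace (TotalSpace ℂ S)] [FiberBundle ℂ S]
    [VectorBundle ℂ ℂ S] [ContMDiffVectorBundle ω ℂ S 𝓘(ℂ)] (σ : SpinStructure M S)
    (m : ℕ) (ψ : Fin m → Spinor M S) (lam : ℝ) (hlam : lam ≠ 0)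
    (heigen : ∀ j x, σ.dirac g (ψ j) x = (lam : ℂ) • ((ψ j).plus x, (ψ j).minus x))
    (hnorm : ∀ x, ∑ j, σ.spinorNormSq g (ψ j) x = 1) :
    g.IsHarmonic (spinorMap ψ (spinorVec_ne_zero σ g ψ hnorm)) := by
  -- The frame in `spinorVec` changes with the point; smooth homogeneous coordinates need one fixed
  -- frame near `x₀`, which only rescales the vector.
  have hmk : ∀ x₀ : M, ∀ᶠ y in 𝓝 x₀, ∃ hy : spinorFrameVec ψ x₀ y ≠ 0,
      spinorMap ψ (spinorVec_ne_zero σ g ψ hnorm) y =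
        Projectivization.mk ℂ (spinorFrameVec ψ x₀ y) hy := by
    intro x₀
    filter_upwards [(trivializationAt ℂ S x₀).open_baseSet.mem_nhds
      (FiberBundle.mem_baseSet_trivializationAt ℂ S x₀)] with y hy
    have hvec : spinorVec ψ y = _ • spinorFrameVec ψ x₀ y := spinorFrameVec_change ψ x₀ y hy
      (FiberBundle.mem_baseSet_trivializationAt ℂ S y)
    have hne := spinorVec_ne_zero σ g ψ hnorm y
    have hy0 : spinorFrameVec ψ x₀ y ≠ 0 := fun h => hne (by rw [hvec, h, smul_zero])
    refine ⟨hy0, ?_⟩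
    rw [spinorMap, Projectivization.mk_eq_mk_iff']
    exact ⟨_, hvec.symm⟩
  refine g.isHarmonic_of_laplacian (fun x => ⟨_, contMDiffAt_spinorFrameVec ψ x, hmk x⟩) ?_
  intro i z₀ hz₀ w hw
  obtain ⟨hne, hx⟩ := (hmk ((chartAt ℂ i).symm z₀)).self_of_nhds
  obtain ⟨c, hc, hrep⟩ := rep_mk_eq hne
  rw [hx, hrep] at hw ⊢
  have hev : (fun z => lineProj (spinorMap ψ (spinorVec_ne_zero σ g ψ hnorm)
      ((chartAt ℂ i).symm z))) =ᶠ[𝓝 z₀] fun z => rankOneProj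
        (spinorFrameVec ψ ((chartAt ℂ i).symm z₀) ((chartAt ℂ i).symm z)) := by
    filter_upwards [((chartAt ℂ i).continuousAt_symm hz₀).eventually
      (hmk ((chartAt ℂ i).symm z₀))] with z hz
    obtain ⟨h1, h2⟩ := hz
    rw [h2, lineProj_mk]
  rw [hev.planeLaplacian_eq]
  rw [inner_smul_left, mul_eq_zero] at hw
  exact inner_planeLaplacian_spinorFrameVec σ g heigen hnorm i hz₀ rfl
    (hw.resolve_left (by simpa using hc))
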